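/- Setting. Manifolds are smooth, finite-dimensional, Hausdorff, second countable and without boundary. Let $(M,\pi)$ be a Poisson manifold and $\iota:S\hookrightarrow M$ an embedded Poisson submanifold with Poisson structure $\psi$, so that $\pi_{\iota(x)}(\alpha,\beta)=\psi_x(\iota^*\alpha,\iota^*\beta)$ for $x\in S$ and $\alpha,\beta\in T^*_{\iota(x)}M$. Let $E\to S$ be the normal bundle of $S$ and $\mathbf e$ an exponential map: a diffeomorphism from an open neighborhood of the zero section of $E$ onto an open neighborhood of $S$ in $M$ that restricts to $\iota$ on the zero section and whose vertical derivative there induces the identification of $E$ with the normal bundle. The conormal bundle $E^*\simeq TS^\circ$ is a bundle of Lie algebras: for $\alpha,\beta\in T_xS^\circ$ and smooth functions $f,g$ near $\iota(x)$ with $d_{\iota(x)}f=\alpha$, $d_{\iota(x)}g=\beta$, put $[\alpha,\beta]_1=d_{\iota(x)}\{f,g\}_\pi$, which depends only on $\alpha,\beta$. Let $C^\infty_{\mathrm{aff}}(E)\simeq C^\infty(S)\oplus\Gamma E^*$ be the space of smooth functions on $E$ that are affine on the fibers, with the product $(f\oplus\eta)\cdot(g\oplus\xi)=fg\oplus(f\xi+g\eta)$.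 The infinitesimal Poisson algebra of $S$ is $\mathscr P=(C^\infty_{\mathrm{aff}}(E),\cdot,\{\cdot,\cdot\}^{\mathrm{aff}})$, where $\{\phi_1,\phi_2\}^{\mathrm{aff}}$ is the unique fiberwise affine function such that $\{\phi_1\circ\mathbf e^{-1},\phi_2\circ\mathbf e^{-1}\}_\pi\circ\mathbf e-\{\phi_1,\phi_2\}^{\mathrm{aff}}$ vanishes to second order along the zero section. Its first cohomology $\mathrm H^1(\mathscr P)$ is the space of $\mathbb R$-linear maps $X:\mathscr P\to\mathscr P$ that are derivations of both the product and the bracket, modulo the Hamiltonian derivations $\{\phi,\cdot\}^{\mathrm{aff}}$, $\phi\in\mathscr P$. Proposition 2.2. Suppose that $E^*$ is a locally trivial bundle of Lie algebras: there is a Lie algebra $\mathfrak g$ such that around each point of $S$ the bundle $E^*$ admits a smooth local trivialization with fiber $\mathfrak g$ that is a Lie algebra isomorphism on each fiber. Suppose that the finite-dimensional real Lie algebra $\mathfrak g$ is semisimple of compact type (semisimple with negative definite Killing form), and that the first Poisson cohomology of $(S,\psi)$ vanishes, that is, every smooth vector field $X$ on $S$ with $L_X\psi=0$ is Hamiltonian,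 $X=\psi(dh,\cdot)$ with $h\in C^\infty(S)$. Then $\mathrm H^1(\mathscr P)=\{0\}$. -/

import Mathlib

open Set Filter
open scoped Manifold ContDiff Topology

noncomputable section

namespace PoissonGeometry

/-! ### Poisson manifolds

All manifolds are smooth, finite-dimensional and without boundary: they are modelled on a
finite-dimensional real normed space `V` through the trivial model `𝓘(ℝ, V)`. -/

section PoissonManifold

variable {V : Type*} [NormedAddCommGroup V] [NormedSpace ℝ V]
  {M : Type*} [TopologicalSpace M] [ChartedSpace V M]

/-- The cotangent space `T*_p M`. -/
abbrev Cotangent (V : Type*) [NormedAddCommGroup V] [NormedSpace ℝ V]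
    {M : Type*} [TopologicalSpace M] [ChartedSpace V M] (p : M) : Type _ :=
  TangentSpace 𝓘(ℝ, V) p →L[ℝ] ℝ

/-- The differential `d_p f ∈ T*_p M` of a function `f : M → ℝ`. -/
def differential (V : Type*) [NormedAddCommGroup V] [NormedSpace ℝ V]
    {M : Type*} [TopologicalSpace M] [ChartedSpace V M] (f : M → ℝ) (p : M) : Cotangent V p :=
  mfderiv 𝓘(ℝ, V) 𝓘(ℝ, ℝ) f p

/-- The function that is given by the linear form `L` in the chart at `p`. Its differential at `p`
is `L`, since `T_p M` is identified with `V` through this chart. -/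
def chartLinear (p : M) (L : Cotangent V p) (q : M) : ℝ :=
  (L : V →L[ℝ] ℝ) (extChartAt 𝓘(ℝ, V) p q)

/-- A Poisson structure on `M`, given by its bivector field `π`: a family of alternating bilinear
forms on the cotangent spaces, which is smooth (`π(df, dg)` is smooth for all smooth `f, g`), and
for which the bracket `{f, g} = π(df, dg)` on `C^∞(M)` satisfies the Jacobi identity. -/
structure PoissonStructure (V : Type*) [NormedAddCommGroup V] [NormedSpace ℝ V]
    (M : Type*) [TopologicalSpace M] [ChartedSpace V M] where
  /-- The bivector at a point, as a bilinear form on the cotangent space. -/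
  bivector : ∀ p : M, Cotangent V p →ₗ[ℝ] Cotangent V p →ₗ[ℝ] ℝ
  alternating : ∀ (p : M) (α : Cotangent V p), bivector p α α = 0
  smooth : ∀ f g : C^∞⟮𝓘(ℝ, V), M; 𝓘(ℝ, ℝ), ℝ⟯,
    ContMDiff 𝓘(ℝ, V) 𝓘(ℝ, ℝ) ∞
      (fun p => bivector p (differential V f p) (differential V g p))
  jacobi : ∀ (f g h : C^∞⟮𝓘(ℝ, V), M; 𝓘(ℝ, ℝ), ℝ⟯) (p : M),
    bivector p (differential V f p)
        (differential V (fun q => bivector q (differential V g q) (differential V h q)) p)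
      + bivector p (differential V g p)
        (differential V (fun q => bivector q (differential V h q) (differential V f q)) p)
      + bivector p (differential V h p)
        (differential V (fun q => bivector q (differential V f q) (differential V g q)) p) = 0

namespace PoissonStructure

/-- The Poisson bracket `{f, g} = π(df, dg)`. It is also applied to functions which are only
smooth on an open set, and is then only looked at on that open set. -/
def bracket (π : PoissonStructure V M) (f g : M → ℝ) (p : M) : ℝ :=
  π.bivector p (differential V f p) (differential V g p)

/-- A vector field `X` on `M` is a Poisson vector field if it is smooth and `L_X π = 0`, that is,
`X{f, g} = {X f, g} + {f, X g}` for all smooth functions `f, g`. -/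
structure IsPoissonVectorField [IsManifold 𝓘(ℝ, V) ∞ M] (π : PoissonStructure V M)
    (X : ∀ p : M, TangentSpace 𝓘(ℝ, V) p) : Prop where
  smooth : ContMDiff 𝓘(ℝ, V) 𝓘(ℝ, V).tangent ∞
    (fun p => (⟨p, X p⟩ : TangentBundle 𝓘(ℝ, V) M))
  leibniz : ∀ (f g : C^∞⟮𝓘(ℝ, V), M; 𝓘(ℝ, ℝ), ℝ⟯) (p : M),
    differential V (π.bracket f g) p (X p)
      = π.bracket (fun q => differential V f q (X q)) g p
        + π.bracket f (fun q => differential V g q (X q)) p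

/-- `X` is a Hamiltonian vector field: `X = π(dh, ·)` for a smooth function `h`. -/
def IsHamiltonianVectorField (π : PoissonStructure V M)
    (X : ∀ p : M, TangentSpace 𝓘(ℝ, V) p) : Prop :=
  ∃ h : C^∞⟮𝓘(ℝ, V), M; 𝓘(ℝ, ℝ), ℝ⟯, ∀ (p : M) (α : Cotangent V p),
    α (X p) = π.bivector p (differential V h p) α

/-- The first Poisson cohomology of `(M, π)`, that is, Poisson vector fields modulo Hamiltonian
vector fields, is trivial. -/
def FirstCohomologyTrivial [IsManifold 𝓘(ℝ, V) ∞ M] (π : PoissonStructure V M) : Prop :=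
  ∀ X : ∀ p : M, TangentSpace 𝓘(ℝ, V) p, π.IsPoissonVectorField X → π.IsHamiltonianVectorField X

/-- The Lie bracket on the kernel of `π_p : T*_p M → T_p M` induced by the cotangent Lie
algebroid. The bracket of the algebroid satisfies `[df, dg] = d{f, g}`, and for covectors in the
kernel of `π_p` the value at `p` depends only on the values of the two forms at `p`; so it is
computed here with the functions that are linear in the chart at `p` and have differentials
`α` and `β` at `p`. In the coordinates of this chart, `[α, β]_k = ∂_k π^{ij}(p) α_i β_j`. -/
def isotropyBracket (π : PoissonStructure V M) (p : M) (α β : Cotangent V p) : Cotangent V p :=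
  differential V (π.bracket (chartLinear p α) (chartLinear p β)) p

end PoissonStructure

end PoissonManifold

/-! ### Poisson submanifolds and their conormal bundles -/

section Submanifold

variable {V : Type*} [NormedAddCommGroup V] [NormedSpace ℝ V]
  {M : Type*} [TopologicalSpace M] [ChartedSpace V M]
  {W : Type*} [NormedAddCommGroup W] [NormedSpace ℝ W]
  {S : Type*} [TopologicalSpace S] [ChartedSpace W S]

/-- `(S, ψ)` is an embedded Poisson submanifold of `(M, π)` through `ι`: the map `ι` is a smooth
embedding and `ι_* ψ = π` along `S`. -/
structure IsPoissonSubmanifold (ψ : PoissonStructure W S) (π : PoissonStructure V M)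
    (ι : S → M) : Prop where
  embedding : Manifold.IsSmoothEmbedding 𝓘(ℝ, W) 𝓘(ℝ, V) ∞ ι
  poisson : ∀ (x : S) (α β : Cotangent V (ι x)),
    π.bivector (ι x) α β
      = ψ.bivector x (α.comp (mfderiv 𝓘(ℝ, W) 𝓘(ℝ, V) ι x))
          (β.comp (mfderiv 𝓘(ℝ, W) 𝓘(ℝ, V) ι x))

/-- The fiber at `x` of the conormal bundle `TS° ⊂ T*_S M`: the covectors that vanish
on `T_x S`. -/
def conormalSpace (V W : Type*) [NormedAddCommGroup V] [NormedSpace ℝ V]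
    [NormedAddCommGroup W] [NormedSpace ℝ W]
    {M : Type*} [TopologicalSpace M] [ChartedSpace V M]
    {S : Type*} [TopologicalSpace S] [ChartedSpace W S]
    (ι : S → M) (x : S) : Submodule ℝ (Cotangent V (ι x)) where
  carrier := {α | ∀ v : TangentSpace 𝓘(ℝ, W) x, α (mfderiv 𝓘(ℝ, W) 𝓘(ℝ, V) ι x v) = 0}
  add_mem' := fun {α β} hα hβ v => by
    change α _ + β _ = 0
    rw [hα v, hβ v, add_zero]
  zero_mem' := fun _ => rfl
  smul_mem' := fun c α hα v => by
    change c • α _ = 0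
    rw [hα v, smul_zero]

/-- The conormal bundle `TS°` of a Poisson submanifold, with the Lie brackets of its fibers,
is a locally trivial Lie algebra bundle with typical fiber `𝔤`: around each point of `S` there
are linear isomorphisms `φ x : 𝔤 → T_x S°` that preserve the Lie brackets and depend
smoothly on `x`, that is, `x ↦ φ x a` is a smooth section of `T*_S M` for each `a` in `𝔤`. -/
def IsLocallyTrivialLieBundle [IsManifold 𝓘(ℝ, V) ∞ M] (W : Type*)
    [NormedAddCommGroup W] [NormedSpace ℝ W] {S : Type*} [TopologicalSpace S] [ChartedSpace W S]
    (π : PoissonStructure V M) (ι : S → M)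
    (𝔤 : Type*) [LieRing 𝔤] [LieAlgebra ℝ 𝔤] : Prop :=
  ∀ x₀ : S, ∃ U : Set S, IsOpen U ∧ x₀ ∈ U ∧
    ∃ φ : ∀ x : S, 𝔤 →ₗ[ℝ] Cotangent V (ι x),
      (∀ x ∈ U, Function.Injective (φ x)) ∧
      (∀ x ∈ U, LinearMap.range (φ x) = conormalSpace V W ι x) ∧
      (∀ x ∈ U, ∀ a b : 𝔤, φ x ⁅a, b⁆ = π.isotropyBracket (ι x) (φ x a) (φ x b)) ∧
      (∀ a : 𝔤, ContMDiffOn 𝓘(ℝ, W) (𝓘(ℝ, V).prod 𝓘(ℝ, V →L[ℝ] ℝ)) ∞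
        (fun x => (Bundle.TotalSpace.mk' (V →L[ℝ] ℝ) (ι x) (φ x a) :
          Bundle.TotalSpace (V →L[ℝ] ℝ)
            (fun p : M => TangentSpace 𝓘(ℝ, V) p →L[ℝ] Bundle.Trivial M ℝ p))) U)

/-- A real Lie algebra is semisimple of compact type if it is semisimple and its Killing form is
negative definite. -/
def IsSemisimpleOfCompactType (𝔤 : Type*) [LieRing 𝔤] [LieAlgebra ℝ 𝔤] : Prop :=
  LieAlgebra.IsSemisimple ℝ 𝔤 ∧ ∀ a : 𝔤, a ≠ 0 → killingForm ℝ 𝔤 a a < 0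

end Submanifold

/-! ### Fiberwise affine functions and exponential maps -/

section AffineFunctions

variable {W : Type*} [NormedAddCommGroup W] [NormedSpace ℝ W]
  {S : Type*} [TopologicalSpace S] [ChartedSpace W S]
  {F : Type*} [NormedAddCommGroup F] [NormedSpace ℝ F]
  {E : S → Type*} [∀ x, AddCommGroup (E x)] [∀ x, Module ℝ (E x)]
  [TopologicalSpace (Bundle.TotalSpace F E)] [∀ x, TopologicalSpace (E x)]
  [FiberBundle F E] [VectorBundle ℝ F E]

/-- The scalar multiplication along the fibers of `E`. -/
def fiberScale (t : ℝ) (w : Bundle.TotalSpace F E) : Bundle.TotalSpace F E :=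
  ⟨w.proj, t • w.snd⟩

/-- The fiberwise affine part of a function `G` on `E`, that is, its first order Taylor expansion
along the fibers at the zero section: `w ↦ G(0_x) + d/dt G(t w)` at `t = 0`, for `w ∈ E_x`. -/
def affinePart (G : Bundle.TotalSpace F E → ℝ) (w : Bundle.TotalSpace F E) : ℝ :=
  G ⟨w.proj, 0⟩ + deriv (fun t : ℝ => G (fiberScale t w)) 0

/-- A function on `E` is fiberwise affine if on each fiber it is a constant plus a linear form. -/
def IsFiberwiseAffine (G : Bundle.TotalSpace F E → ℝ) : Prop :=
  ∀ x : S, ∃ (c : ℝ) (l : E x →ₗ[ℝ] ℝ), ∀ v : E x, G ⟨x, v⟩ = c + l v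

theorem contMDiff_fiberScale :
    ContMDiff (𝓘(ℝ, ℝ).prod (𝓘(ℝ, W).prod 𝓘(ℝ, F))) (𝓘(ℝ, W).prod 𝓘(ℝ, F)) ∞
      (fun p : ℝ × Bundle.TotalSpace F E => fiberScale p.1 p.2) := by
  intro p₀
  rw [Bundle.contMDiffAt_totalSpace]
  have hproj : ContMDiff (𝓘(ℝ, ℝ).prod (𝓘(ℝ, W).prod 𝓘(ℝ, F))) 𝓘(ℝ, W) ∞
      (fun p : ℝ × Bundle.TotalSpace F E => p.2.proj) :=
    (Bundle.contMDiff_proj E).comp contMDiff_snd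
  refine ⟨hproj p₀, ?_⟩
  set T := trivializationAt F E (fiberScale p₀.1 p₀.2).proj with hT
  have hmem : p₀.2.proj ∈ T.baseSet := FiberBundle.mem_baseSet_trivializationAt' _
  have h2 : ContMDiffAt (𝓘(ℝ, ℝ).prod (𝓘(ℝ, W).prod 𝓘(ℝ, F))) 𝓘(ℝ, F) ∞
      (fun p : ℝ × Bundle.TotalSpace F E => (T p.2).2) p₀ :=
    ((Bundle.contMDiffAt_totalSpace (f := fun p : ℝ × Bundle.TotalSpace F E => p.2)).1
      contMDiffAt_snd).2
  have h1 : ContMDiffAt (𝓘(ℝ, ℝ).prod (𝓘(ℝ, W).prod 𝓘(ℝ, F))) 𝓘(ℝ, F) ∞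
      (fun p : ℝ × Bundle.TotalSpace F E => p.1 • (T p.2).2) p₀ :=
    contMDiffAt_fst.smul h2
  refine h1.congr_of_eventuallyEq ?_
  filter_upwards [hproj.continuous.continuousAt.preimage_mem_nhds
    (T.open_baseSet.mem_nhds hmem)] with p hp
  exact (T.linear ℝ hp).map_smul p.1 p.2.snd

/-- The fiberwise affine part of a function which is smooth along the zero section is smooth. -/
theorem contMDiff_affinePart [IsManifold 𝓘(ℝ, W) ∞ S] [ContMDiffVectorBundle ∞ F E 𝓘(ℝ, W)]
    {G : Bundle.TotalSpace F E → ℝ}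
    (hG : ∀ x : S, ContMDiffAt (𝓘(ℝ, W).prod 𝓘(ℝ, F)) 𝓘(ℝ, ℝ) ∞ G ⟨x, 0⟩) :
    ContMDiff (𝓘(ℝ, W).prod 𝓘(ℝ, F)) 𝓘(ℝ, ℝ) ∞ (affinePart G) := by
  have : IsManifold (𝓘(ℝ, W).prod 𝓘(ℝ, F)) 1 (Bundle.TotalSpace F E) :=
    IsManifold.of_le (n := ∞) (by exact_mod_cast le_top)
  intro w₀
  have hz : ContMDiff (𝓘(ℝ, W).prod 𝓘(ℝ, F)) (𝓘(ℝ, W).prod 𝓘(ℝ, F)) ∞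
      (fun w : Bundle.TotalSpace F E => (⟨w.proj, 0⟩ : Bundle.TotalSpace F E)) :=
    (Bundle.contMDiff_zeroSection ℝ E).comp (Bundle.contMDiff_proj E)
  have hscale : ∀ w : Bundle.TotalSpace F E, fiberScale 0 w = ⟨w.proj, 0⟩ := fun w => by
    simp [fiberScale]
  refine ContMDiffAt.add (ContMDiffAt.comp w₀ (hG w₀.proj) (hz w₀)) ?_
  have hu : ContMDiffAt ((𝓘(ℝ, W).prod 𝓘(ℝ, F)).prod 𝓘(ℝ, ℝ)) 𝓘(ℝ, ℝ) ∞
      (Function.uncurry (fun (w : Bundle.TotalSpace F E) (t : ℝ) => G (fiberScale t w)))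
      (w₀, (0 : ℝ)) := by
    have hs : ContMDiffAt ((𝓘(ℝ, W).prod 𝓘(ℝ, F)).prod 𝓘(ℝ, ℝ)) (𝓘(ℝ, W).prod 𝓘(ℝ, F)) ∞
        (fun q : Bundle.TotalSpace F E × ℝ => fiberScale q.2 q.1) (w₀, (0 : ℝ)) :=
      (contMDiff_fiberScale.comp (contMDiff_snd.prodMk contMDiff_fst)).contMDiffAt
    refine ContMDiffAt.comp (g := G) (f := fun q : Bundle.TotalSpace F E × ℝ => fiberScale q.2 q.1)
      (w₀, (0 : ℝ)) ?_ hs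
    simp only [hscale]
    exact hG w₀.proj
  have h := ContMDiffAt.mfderiv_apply (m := ∞) (n := ∞) (x₀ := w₀)
    (fun (w : Bundle.TotalSpace F E) (t : ℝ) => G (fiberScale t w))
    (fun _ => (0 : ℝ)) id (fun _ => (1 : ℝ)) hu contMDiffAt_const contMDiffAt_id contMDiffAt_const
    (by simp)
  simp only [inTangentCoordinates_model_space, mfderiv_eq_fderiv] at h
  exact h

/-- The fiberwise affine part of a function which is smooth along the zero section is
fiberwise affine. -/
theorem isFiberwiseAffine_affinePart
    {G : Bundle.TotalSpace F E → ℝ}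
    (hG : ∀ x : S, ContMDiffAt (𝓘(ℝ, W).prod 𝓘(ℝ, F)) 𝓘(ℝ, ℝ) ∞ G ⟨x, 0⟩) :
    IsFiberwiseAffine (affinePart G) := by
  intro x
  set T := trivializationAt F E x with hT
  have hx : x ∈ T.baseSet := FiberBundle.mem_baseSet_trivializationAt' x
  have hj : ContMDiff 𝓘(ℝ, F) (𝓘(ℝ, W).prod 𝓘(ℝ, F)) ∞
      (fun u : F => (⟨x, T.symmL ℝ x u⟩ : Bundle.TotalSpace F E)) := by
    intro u
    rw [Bundle.contMDiffAt_totalSpace]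
    refine ⟨contMDiffAt_const, ?_⟩
    have : (fun v : F => (T (⟨x, T.symmL ℝ x v⟩ : Bundle.TotalSpace F E)).2) = fun v => v := by
      funext v
      rw [T.symmL_apply hx]
      exact congrArg Prod.snd (T.apply_mk_symm hx v)
    change ContMDiffAt 𝓘(ℝ, F) 𝓘(ℝ, F) ∞
      (fun v : F => (T (⟨x, T.symmL ℝ x v⟩ : Bundle.TotalSpace F E)).2) u
    rw [this]
    exact contMDiffAt_id
  have hg : DifferentiableAt ℝ (fun u : F => G ⟨x, T.symmL ℝ x u⟩) 0 := by
    have : ContMDiffAt 𝓘(ℝ, F) 𝓘(ℝ, ℝ) ∞ (fun u : F => G ⟨x, T.symmL ℝ x u⟩) 0 := by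
      refine ContMDiffAt.comp (g := G)
        (f := fun u : F => (⟨x, T.symmL ℝ x u⟩ : Bundle.TotalSpace F E)) 0 ?_ (hj 0)
      rw [map_zero]
      exact hG x
    exact (contMDiffAt_iff_contDiffAt.1 this).differentiableAt (by simp)
  refine ⟨G ⟨x, 0⟩, (fderiv ℝ (fun u : F => G ⟨x, T.symmL ℝ x u⟩) 0).toLinearMap ∘ₗ
    (T.continuousLinearMapAt ℝ x).toLinearMap, fun v => ?_⟩
  have hline : HasDerivAt (fun t : ℝ => t • T.continuousLinearMapAt ℝ x v)
      (T.continuousLinearMapAt ℝ x v) 0 := by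
    simpa using (hasDerivAt_id (0 : ℝ)).smul_const (T.continuousLinearMapAt ℝ x v)
  have hcomp := (show HasFDerivAt (fun u : F => G ⟨x, T.symmL ℝ x u⟩)
    (fderiv ℝ (fun u : F => G ⟨x, T.symmL ℝ x u⟩) 0)
      ((fun t : ℝ => t • T.continuousLinearMapAt ℝ x v) 0) by
        simpa using hg.hasFDerivAt).comp_hasDerivAt (0 : ℝ) hline
  have heq : (fun t : ℝ => G (fiberScale t (⟨x, v⟩ : Bundle.TotalSpace F E)))
      = (fun u : F => G ⟨x, T.symmL ℝ x u⟩) ∘ fun t : ℝ => t • T.continuousLinearMapAt ℝ x v := by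
    funext t
    simp only [Function.comp_apply, map_smul, T.symmL_continuousLinearMapAt hx, fiberScale]
  simp only [affinePart, heq]
  rw [hcomp.deriv]
  rfl

variable (W F E) in
/-- The space `C^∞_aff(E)` of smooth fiberwise affine functions on `E`. -/
def affineFunctions :
    Submodule ℝ C^∞⟮𝓘(ℝ, W).prod 𝓘(ℝ, F), Bundle.TotalSpace F E; 𝓘(ℝ, ℝ), ℝ⟯ where
  carrier := {φ | IsFiberwiseAffine φ}
  add_mem' := fun {φ χ} hφ hχ x => by
    obtain ⟨c, l, h⟩ := hφ x
    obtain ⟨c', l', h'⟩ := hχ x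
    refine ⟨c + c', l + l', fun v => ?_⟩
    change φ _ + χ _ = _
    rw [h v, h' v, LinearMap.add_apply]
    ring
  zero_mem' := fun _ => ⟨0, 0, fun _ => by simp⟩
  smul_mem' := fun r φ hφ x => by
    obtain ⟨c, l, h⟩ := hφ x
    refine ⟨r * c, r • l, fun v => ?_⟩
    change r • φ _ = _
    rw [h v, LinearMap.smul_apply, smul_eq_mul, smul_eq_mul]
    ring

variable [IsManifold 𝓘(ℝ, W) ∞ S] [ContMDiffVectorBundle ∞ F E 𝓘(ℝ, W)]

/-- The fiberwise affine part as an element of `C^∞_aff(E)`. -/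
def toAffine (G : Bundle.TotalSpace F E → ℝ)
    (hG : ∀ x : S, ContMDiffAt (𝓘(ℝ, W).prod 𝓘(ℝ, F)) 𝓘(ℝ, ℝ) ∞ G ⟨x, 0⟩) :
    affineFunctions W F E :=
  ⟨⟨affinePart G, contMDiff_affinePart hG⟩, isFiberwiseAffine_affinePart hG⟩

/-- The commutative product on `C^∞_aff(E)`: the fiberwise affine part of the pointwise product.
For `φ = f ⊕ η` and `χ = g ⊕ ξ` in `C^∞(S) ⊕ Γ(E*)` it is `fg ⊕ (fξ + gη)`. -/
def affineMul (φ χ : affineFunctions W F E) : affineFunctions W F E :=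
  toAffine (fun w => φ.1 w * χ.1 w) fun _ => (φ.1.contMDiff.contMDiffAt).mul χ.1.contMDiff.contMDiffAt

/-- The product of `f ⊕ η` and `g ⊕ ξ` is `fg ⊕ (fξ + gη)`. -/
theorem affineMul_apply (φ χ : affineFunctions W F E) (x : S) (v : E x) :
    (affineMul φ χ).1 ⟨x, v⟩ = φ.1 ⟨x, 0⟩ * χ.1 ⟨x, 0⟩
      + (φ.1 ⟨x, 0⟩ * (χ.1 ⟨x, v⟩ - χ.1 ⟨x, 0⟩) + χ.1 ⟨x, 0⟩ * (φ.1 ⟨x, v⟩ - φ.1 ⟨x, 0⟩)) := by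
  obtain ⟨c, l, h⟩ := φ.2 x
  obtain ⟨c', l', h'⟩ := χ.2 x
  change φ.1 ⟨x, 0⟩ * χ.1 ⟨x, 0⟩
    + deriv (fun t : ℝ => φ.1 ⟨x, t • v⟩ * χ.1 ⟨x, t • v⟩) 0 = _
  have hd : HasDerivAt (fun t : ℝ => (c + t * l v) * (c' + t * l' v))
      (l v * (c' + 0 * l' v) + (c + 0 * l v) * l' v) 0 := by
    have h1 : ∀ a b : ℝ, HasDerivAt (fun t : ℝ => a + t * b) b 0 := fun a b => by
      simpa using ((hasDerivAt_id (0 : ℝ)).mul_const b).const_add a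
    exact (h1 c (l v)).mul (h1 c' (l' v))
  simp only [h, h', map_smul, smul_eq_mul, map_zero]
  rw [hd.deriv]
  ring

end AffineFunctions

section InfinitesimalPoissonAlgebra

variable {V : Type*} [NormedAddCommGroup V] [NormedSpace ℝ V]
  {M : Type*} [TopologicalSpace M] [ChartedSpace V M]
  {W : Type*} [NormedAddCommGroup W] [NormedSpace ℝ W]
  {S : Type*} [TopologicalSpace S] [ChartedSpace W S]

/-- An exponential map `e : E → M` of the submanifold `ι : S → M`: a diffeomorphism from an open
neighborhood of the zero section of a vector bundle `E` over `S` (possibly all of `E`) onto an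
open neighborhood of `S` in `M`, which restricts to `ι` on the zero section. Its vertical
derivative at the zero section identifies `E_x` with `T_{ι x} M / T_x S`, so that `E` is the normal
bundle of `S`. -/
structure ExponentialMap (V W : Type*) [NormedAddCommGroup V] [NormedSpace ℝ V]
    [NormedAddCommGroup W] [NormedSpace ℝ W]
    {M : Type*} [TopologicalSpace M] [ChartedSpace V M]
    {S : Type*} [TopologicalSpace S] [ChartedSpace W S] (ι : S → M)
    (F : Type*) [NormedAddCommGroup F] [NormedSpace ℝ F]
    (E : S → Type*) [∀ x, AddCommGroup (E x)] [∀ x, Module ℝ (E x)]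
    [TopologicalSpace (Bundle.TotalSpace F E)] [∀ x, TopologicalSpace (E x)]
    [FiberBundle F E] [VectorBundle ℝ F E] where
  /-- The underlying homeomorphism between open sets. -/
  toHomeo : OpenPartialHomeomorph (Bundle.TotalSpace F E) M
  smooth : ContMDiffOn (𝓘(ℝ, W).prod 𝓘(ℝ, F)) 𝓘(ℝ, V) ∞ toHomeo toHomeo.source
  smooth_symm : ContMDiffOn 𝓘(ℝ, V) (𝓘(ℝ, W).prod 𝓘(ℝ, F)) ∞ toHomeo.symm toHomeo.target
  zero_mem : ∀ x : S, (⟨x, 0⟩ : Bundle.TotalSpace F E) ∈ toHomeo.source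
  map_zero : ∀ x : S, toHomeo ⟨x, 0⟩ = ι x

/-- A function which is smooth on an open set agrees near each point of the set with a globally
smooth function. -/
theorem exists_smooth_extension [FiniteDimensional ℝ V] [IsManifold 𝓘(ℝ, V) ∞ M] [T2Space M]
    {f : M → ℝ} {U : Set M} (hU : IsOpen U) (hf : ContMDiffOn 𝓘(ℝ, V) 𝓘(ℝ, ℝ) ∞ f U)
    {p : M} (hp : p ∈ U) :
    ∃ g : C^∞⟮𝓘(ℝ, V), M; 𝓘(ℝ, ℝ), ℝ⟯, ⇑g =ᶠ[𝓝 p] f := by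
  obtain ⟨b, -, hb⟩ := (SmoothBumpFunction.nhds_basis_tsupport (I := 𝓘(ℝ, V)) p).mem_iff.1
    (hU.mem_nhds hp)
  refine ⟨⟨fun q => b q * f q, ?_⟩, ?_⟩
  · refine contMDiff_of_tsupport fun q hq => ?_
    have hqU : q ∈ U := hb (tsupport_smul_subset_left (⇑b) f hq)
    exact b.contMDiffAt.mul (hf.contMDiffAt (hU.mem_nhds hqU))
  · filter_upwards [b.eventuallyEq_one] with q hq
    change b q * f q = f q
    rw [hq]
    simp

/-- The bracket of two functions which are smooth on an open set is smooth on that set. -/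
theorem PoissonStructure.contMDiffAt_bracket [FiniteDimensional ℝ V] [IsManifold 𝓘(ℝ, V) ∞ M]
    [T2Space M] (π : PoissonStructure V M) {f g : M → ℝ} {U : Set M} (hU : IsOpen U)
    (hf : ContMDiffOn 𝓘(ℝ, V) 𝓘(ℝ, ℝ) ∞ f U) (hg : ContMDiffOn 𝓘(ℝ, V) 𝓘(ℝ, ℝ) ∞ g U)
    {p : M} (hp : p ∈ U) :
    ContMDiffAt 𝓘(ℝ, V) 𝓘(ℝ, ℝ) ∞ (π.bracket f g) p := by
  obtain ⟨f', hf'⟩ := exists_smooth_extension hU hf hp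
  obtain ⟨g', hg'⟩ := exists_smooth_extension hU hg hp
  refine (π.smooth f' g' p).congr_of_eventuallyEq ?_
  filter_upwards [hf'.eventuallyEq_nhds, hg'.eventuallyEq_nhds] with q hq hq'
  simp only [PoissonStructure.bracket, differential, hq.mfderiv_eq, hq'.mfderiv_eq]

/-- Near `p`, the differential of `f` is a combination of the differentials of the coordinates of
the chart at `p`. -/
theorem differential_eq_sum [FiniteDimensional ℝ V] [IsManifold 𝓘(ℝ, V) ∞ M]
    {f : M → ℝ} {p q : M} (hq : q ∈ (extChartAt 𝓘(ℝ, V) p).source)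
    (hf : ContMDiffAt 𝓘(ℝ, V) 𝓘(ℝ, ℝ) ∞ f q) :
    differential V f q = ∑ i, fderiv ℝ (f ∘ (extChartAt 𝓘(ℝ, V) p).symm) (extChartAt 𝓘(ℝ, V) p q)
        (Module.finBasis ℝ V i) •
      differential V (fun r => ((Module.finBasis ℝ V).coord i).toContinuousLinearMap
        (extChartAt 𝓘(ℝ, V) p r)) q := by
  set b := Module.finBasis ℝ V
  set c := extChartAt 𝓘(ℝ, V) p with hc
  have hcd : MDifferentiableAt 𝓘(ℝ, V) 𝓘(ℝ, V) c q :=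
    (contMDiffAt_extChartAt' (I := 𝓘(ℝ, V)) (n := ∞)
      (by simpa [c, extChartAt_source] using hq)).mdifferentiableAt (by simp)
  have hlin : ∀ L : V →L[ℝ] ℝ, differential V (fun r => L (c r)) q
      = L.comp (mfderiv 𝓘(ℝ, V) 𝓘(ℝ, V) c q) := fun L => by
    have := mfderiv_comp (I'' := 𝓘(ℝ, ℝ)) q (L.differentiableAt.mdifferentiableAt) hcd
    rw [mfderiv_eq_fderiv, L.fderiv] at this
    exact this
  have hs : ContMDiffAt 𝓘(ℝ, V) 𝓘(ℝ, ℝ) ∞ (f ∘ c.symm) (c q) := by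
    refine ContMDiffAt.comp (c q) ?_
      (contMDiffOn_extChartAt_symm (n := ∞) p |>.contMDiffAt (extChartAt_target_mem_nhds' ?_))
    · rwa [c.left_inv hq]
    · exact c.map_source hq
  have hfd : MDifferentiableAt 𝓘(ℝ, V) 𝓘(ℝ, ℝ) (f ∘ c.symm) (c q) :=
    hs.mdifferentiableAt (by simp)
  have hcomp : differential V f q
      = (fderiv ℝ (f ∘ c.symm) (c q)).comp (mfderiv 𝓘(ℝ, V) 𝓘(ℝ, V) c q) := by
    have h1 : f =ᶠ[𝓝 q] (f ∘ c.symm) ∘ c := by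
      filter_upwards [extChartAt_source_mem_nhds' hq] with r hr
      simp [Function.comp_apply, c.left_inv hr]
    have := mfderiv_comp (I'' := 𝓘(ℝ, ℝ)) q hfd hcd
    rw [mfderiv_eq_fderiv] at this
    exact h1.mfderiv_eq.trans this
  rw [hcomp]
  simp only [hlin]
  ext v
  set u : V := mfderiv 𝓘(ℝ, V) 𝓘(ℝ, V) c q v with hu
  change fderiv ℝ (f ∘ c.symm) (c q) u = _
  conv_lhs => rw [← b.sum_repr u, map_sum]
  rw [sum_apply]
  refine Finset.sum_congr rfl fun i _ => ?_
  rw [map_smul]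
  change b.repr u i * _ = _ * b.coord i u
  rw [Module.Basis.coord_apply, mul_comm]

/-- If `d_p f = 0` and `d_p g` lies in the kernel of `π_p`, then `d_p {f, g} = 0`. -/
theorem PoissonStructure.differential_bracket_eq_zero [FiniteDimensional ℝ V]
    [IsManifold 𝓘(ℝ, V) ∞ M] [T2Space M] (π : PoissonStructure V M) {f g : M → ℝ} {U : Set M}
    (hU : IsOpen U) (hf : ContMDiffOn 𝓘(ℝ, V) 𝓘(ℝ, ℝ) ∞ f U)
    (hg : ContMDiffOn 𝓘(ℝ, V) 𝓘(ℝ, ℝ) ∞ g U) {p : M} (hp : p ∈ U)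
    (hf0 : differential V f p = 0) (hg0 : ∀ α, π.bivector p α (differential V g p) = 0) :
    differential V (π.bracket f g) p = 0 := by
  set c := extChartAt 𝓘(ℝ, V) p with hc
  set b := Module.finBasis ℝ V
  set a : Fin (Module.finrank ℝ V) → M → ℝ :=
    fun i q => fderiv ℝ (f ∘ c.symm) (c q) (b i) with ha
  set y : Fin (Module.finrank ℝ V) → M → ℝ :=
    fun i r => (b.coord i).toContinuousLinearMap (c r) with hy
  have hO : IsOpen (U ∩ c.source) := hU.inter (isOpen_extChartAt_source p)
  have hpO : p ∈ U ∩ c.source := ⟨hp, mem_extChartAt_source p⟩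
  have hsum : π.bracket f g =ᶠ[𝓝 p] fun q => ∑ i, a i q * π.bracket (y i) g q := by
    filter_upwards [hO.mem_nhds hpO] with q hq
    simp only [PoissonStructure.bracket]
    rw [differential_eq_sum hq.2 (hf.contMDiffAt (hU.mem_nhds hq.1))]
    simp only [map_sum, map_smul, LinearMap.sum_apply, LinearMap.smul_apply, smul_eq_mul]
    rfl
  have hysm : ∀ i, ContMDiffOn 𝓘(ℝ, V) 𝓘(ℝ, ℝ) ∞ (y i) (U ∩ c.source) := fun i q hq => by
    refine ContMDiffAt.contMDiffWithinAt ?_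
    exact ((b.coord i).toContinuousLinearMap.contMDiff (n := ∞)).contMDiffAt.comp q
      (contMDiffAt_extChartAt' (by simpa [c, extChartAt_source] using hq.2))
  have hBd : ∀ i, MDifferentiableAt 𝓘(ℝ, V) 𝓘(ℝ, ℝ) (π.bracket (y i) g) p := fun i =>
    (π.contMDiffAt_bracket hO (hysm i) (hg.mono inter_subset_left) hpO).mdifferentiableAt (by simp)
  have hB0 : ∀ i, π.bracket (y i) g p = 0 := fun i => hg0 _
  have hcd : ContMDiffAt 𝓘(ℝ, V) 𝓘(ℝ, V) ∞ c p := contMDiffAt_extChartAt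
  have hfs : ContDiffAt ℝ ∞ (f ∘ c.symm) (c p) := by
    refine ContMDiffAt.contDiffAt (ContMDiffAt.comp (c p) ?_
      (contMDiffOn_extChartAt_symm (n := ∞) p |>.contMDiffAt (extChartAt_target_mem_nhds p)))
    rw [extChartAt_to_inv]
    exact hf.contMDiffAt (hU.mem_nhds hp)
  have had : ∀ i, MDifferentiableAt 𝓘(ℝ, V) 𝓘(ℝ, ℝ) (a i) p := fun i => by
    have h1 : ContDiffAt ℝ ∞ (fun z => fderiv ℝ (f ∘ c.symm) z (b i)) (c p) :=
      (hfs.fderiv_right (m := ∞) (by simp)).clm_apply contDiffAt_const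
    exact (ContMDiffAt.comp p h1.contMDiffAt hcd).mdifferentiableAt (by simp)
  have ha0 : ∀ i, a i p = 0 := fun i => by
    have h1 : MDifferentiableAt 𝓘(ℝ, V) 𝓘(ℝ, ℝ) f (c.symm (c p)) := by
      rw [extChartAt_to_inv]
      exact (hf.contMDiffAt (hU.mem_nhds hp)).mdifferentiableAt (by simp)
    have h2 : MDifferentiableAt 𝓘(ℝ, V) 𝓘(ℝ, V) c.symm (c p) :=
      (contMDiffOn_extChartAt_symm (n := ∞) p |>.contMDiffAt
        (extChartAt_target_mem_nhds p)).mdifferentiableAt (by simp)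
    have h3 := mfderiv_comp (c p) h1 h2
    have h4 : ∀ r : M, r = p → ∀ u, mfderiv 𝓘(ℝ, V) 𝓘(ℝ, ℝ) f r u = 0 := by
      rintro r rfl u
      exact congrArg (fun L => L u) hf0
    rw [mfderiv_eq_fderiv] at h3
    change fderiv ℝ (f ∘ c.symm) (c p) (b i) = 0
    rw [h3]
    exact h4 _ (extChartAt_to_inv p) _
  have hterm : ∀ i, HasMFDerivAt 𝓘(ℝ, V) 𝓘(ℝ, ℝ) (fun q => a i q * π.bracket (y i) g q) p
      (0 : TangentSpace 𝓘(ℝ, V) p →L[ℝ] ℝ) := fun i => by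
    have h := (had i).hasMFDerivAt.mul (hBd i).hasMFDerivAt
    have h0 : a i p • differential V (π.bracket (y i) g) p
        + π.bracket (y i) g p • differential V (a i) p = 0 := by
      rw [ha0 i, hB0 i, zero_smul, zero_smul, add_zero]
    have h' : HasMFDerivAt 𝓘(ℝ, V) 𝓘(ℝ, ℝ) (fun q => a i q * π.bracket (y i) g q) p
        (a i p • differential V (π.bracket (y i) g) p
          + π.bracket (y i) g p • differential V (a i) p) := h
    rw [h0] at h'
    exact h'
  have htot : HasMFDerivAt 𝓘(ℝ, V) 𝓘(ℝ, ℝ) (fun q => ∑ i, a i q * π.bracket (y i) g q) p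
      (0 : TangentSpace 𝓘(ℝ, V) p →L[ℝ] ℝ) := by
    have h := HasMFDerivAt.sum (t := Finset.univ) fun i _ => hterm i
    simp only [Finset.sum_const_zero] at h
    have hfun : (fun q => ∑ i, a i q * π.bracket (y i) g q)
        = ∑ i, fun q => a i q * π.bracket (y i) g q := by
      funext q
      rw [Finset.sum_apply]
    rw [hfun]
    exact h
  exact hsum.mfderiv_eq.trans htot.mfderiv

theorem differential_chartLinear [IsManifold 𝓘(ℝ, V) ∞ M] {p : M} (L : Cotangent V p) :
    differential V (chartLinear p L) p = L := by
  have key : ∀ L : V →L[ℝ] ℝ, differential V (chartLinear p L) p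
      = L.comp (mfderiv 𝓘(ℝ, V) 𝓘(ℝ, V) (chartAt V p) p) := fun L => by
    have h := mfderiv_comp (I'' := 𝓘(ℝ, ℝ)) p (L.differentiableAt.mdifferentiableAt)
      (mdifferentiableAt_atlas (I := 𝓘(ℝ, V)) (chart_mem_atlas V p) (mem_chart_source V p))
    rw [mfderiv_eq_fderiv, L.fderiv] at h
    exact h
  rw [key L, mfderiv_chartAt_eq_tangentCoordChange (mem_chart_source V p)]
  ext v
  have hv : tangentCoordChange 𝓘(ℝ, V) p p p v = v :=
    tangentCoordChange_self (mem_extChartAt_source p)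
  exact congrArg (fun u => L u) hv

/-- For `f, g` with differentials in the kernel of `π_p`, `[d_p f, d_p g] = d_p {f, g}`. -/
theorem PoissonStructure.isotropyBracket_differential [FiniteDimensional ℝ V]
    [IsManifold 𝓘(ℝ, V) ∞ M] [T2Space M] (π : PoissonStructure V M) {f g : M → ℝ} {U : Set M}
    (hU : IsOpen U) (hf : ContMDiffOn 𝓘(ℝ, V) 𝓘(ℝ, ℝ) ∞ f U)
    (hg : ContMDiffOn 𝓘(ℝ, V) 𝓘(ℝ, ℝ) ∞ g U) {p : M} (hp : p ∈ U)
    (hf0 : ∀ α, π.bivector p α (differential V f p) = 0)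
    (hg0 : ∀ α, π.bivector p α (differential V g p) = 0) :
    π.isotropyBracket p (differential V f p) (differential V g p)
      = differential V (π.bracket f g) p := by
  set c := extChartAt 𝓘(ℝ, V) p with hc
  have hO : IsOpen (U ∩ c.source) := hU.inter (isOpen_extChartAt_source p)
  have hpO : p ∈ U ∩ c.source := ⟨hp, mem_extChartAt_source p⟩
  have hcs : ∀ L : V →L[ℝ] ℝ, ContMDiffOn 𝓘(ℝ, V) 𝓘(ℝ, ℝ) ∞ (chartLinear p L)
      (U ∩ c.source) := fun L q hq => by
    refine ContMDiffAt.contMDiffWithinAt ?_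
    exact (L.contMDiff (n := ∞)).contMDiffAt.comp q
      (contMDiffAt_extChartAt' (by simpa [c, extChartAt_source] using hq.2))
  have hcp : ∀ L : Cotangent V p, differential V (chartLinear p L) p = L := differential_chartLinear
  have hff := hf.mono (inter_subset_left (t := c.source))
  have hgg := hg.mono (inter_subset_left (t := c.source))
  set α := differential V f p with hα
  set β := differential V g p with hβ
  have key : ∀ {u v w : M → ℝ}, ContMDiffOn 𝓘(ℝ, V) 𝓘(ℝ, ℝ) ∞ u (U ∩ c.source) →
      ContMDiffOn 𝓘(ℝ, V) 𝓘(ℝ, ℝ) ∞ v (U ∩ c.source) →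
      ContMDiffOn 𝓘(ℝ, V) 𝓘(ℝ, ℝ) ∞ w (U ∩ c.source) →
      differential V u p = differential V v p →
      (∀ γ, π.bivector p γ (differential V w p) = 0) →
      differential V (π.bracket u w) p = differential V (π.bracket v w) p := by
    intro u v w hu hv hw huv hw0
    have hsub : ∀ q ∈ U ∩ c.source, differential V (u - v) q
        = differential V u q - differential V v q := fun q hq =>
      mfderiv_sub ((hu.contMDiffAt (hO.mem_nhds hq)).mdifferentiableAt (by simp))
        ((hv.contMDiffAt (hO.mem_nhds hq)).mdifferentiableAt (by simp))
    have h0 := π.differential_bracket_eq_zero (f := u - v) hO (hu.sub hv) hw hpO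
      (by rw [hsub p hpO, huv, sub_self]) hw0
    have h1 : π.bracket (u - v) w =ᶠ[𝓝 p] π.bracket u w - π.bracket v w := by
      filter_upwards [hO.mem_nhds hpO] with q hq
      simp only [PoissonStructure.bracket, Pi.sub_apply]
      rw [hsub q hq, map_sub, LinearMap.sub_apply]
    have h2 : differential V (π.bracket (u - v) w) p
        = differential V (π.bracket u w) p - differential V (π.bracket v w) p :=
      h1.mfderiv_eq.trans (mfderiv_sub
        ((π.contMDiffAt_bracket hO hu hw hpO).mdifferentiableAt (by simp))
        ((π.contMDiffAt_bracket hO hv hw hpO).mdifferentiableAt (by simp)))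
    rw [h0] at h2
    exact (sub_eq_zero.1 h2.symm)
  have hskew : ∀ u w : M → ℝ, π.bracket u w = -π.bracket w u := fun u w => by
    funext q
    have h := π.alternating q (differential V u q + differential V w q)
    simp only [map_add, LinearMap.add_apply, π.alternating, zero_add, add_zero] at h
    exact eq_neg_of_add_eq_zero_left (by rw [add_comm]; exact h)
  have hneg : ∀ u : M → ℝ, differential V (-u) p = -differential V u p := fun u => mfderiv_neg
  rw [PoissonStructure.isotropyBracket]
  rw [key (hcs α) hff (hcs β) (hcp α) (by rw [hcp β]; exact hg0), hskew, hneg,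
    key (hcs β) hgg hff (hcp β) hf0, ← hneg, ← hskew]

variable [FiniteDimensional ℝ V] [IsManifold 𝓘(ℝ, V) ∞ M] [T2Space M]
  {F : Type*} [NormedAddCommGroup F] [NormedSpace ℝ F]
  {E : S → Type*} [∀ x, AddCommGroup (E x)] [∀ x, Module ℝ (E x)]
  [TopologicalSpace (Bundle.TotalSpace F E)] [∀ x, TopologicalSpace (E x)]
  [FiberBundle F E] [VectorBundle ℝ F E]
  {ι : S → M}

/-- The function `{φ ∘ e⁻¹, χ ∘ e⁻¹}_π ∘ e` on the domain of `e` in `E`. -/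
def pulledBackBracket (π : PoissonStructure V M) (e : ExponentialMap V W ι F E)
    (φ χ : Bundle.TotalSpace F E → ℝ) (w : Bundle.TotalSpace F E) : ℝ :=
  π.bracket (φ ∘ e.toHomeo.symm) (χ ∘ e.toHomeo.symm) (e.toHomeo w)

theorem contMDiffAt_pulledBackBracket (π : PoissonStructure V M) (e : ExponentialMap V W ι F E)
    (φ χ : C^∞⟮𝓘(ℝ, W).prod 𝓘(ℝ, F), Bundle.TotalSpace F E; 𝓘(ℝ, ℝ), ℝ⟯)
    {w : Bundle.TotalSpace F E} (hw : w ∈ e.toHomeo.source) :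
    ContMDiffAt (𝓘(ℝ, W).prod 𝓘(ℝ, F)) 𝓘(ℝ, ℝ) ∞ (pulledBackBracket π e φ χ) w :=
  ContMDiffAt.comp w
    (π.contMDiffAt_bracket e.toHomeo.open_target
      (φ.contMDiff.comp_contMDiffOn e.smooth_symm) (χ.contMDiff.comp_contMDiffOn e.smooth_symm)
      (e.toHomeo.map_source hw))
    (e.smooth.contMDiffAt (e.toHomeo.open_source.mem_nhds hw))

variable [IsManifold 𝓘(ℝ, W) ∞ S] [ContMDiffVectorBundle ∞ F E 𝓘(ℝ, W)]

/-- The bracket of the infinitesimal Poisson algebra `𝒫 = (C^∞_aff(E), ·, {·,·}^aff)`: the unique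
fiberwise affine function with `{φ ∘ e⁻¹, χ ∘ e⁻¹}_π ∘ e = {φ, χ}^aff + O_2` around the zero
section, where `O_2` stands for functions that vanish to second order along the zero section. -/
def affineBracket (π : PoissonStructure V M) (e : ExponentialMap V W ι F E)
    (φ χ : affineFunctions W F E) : affineFunctions W F E :=
  toAffine (pulledBackBracket π e φ.1 χ.1)
    fun x => contMDiffAt_pulledBackBracket π e φ.1 χ.1 (e.zero_mem x)

/-- A derivation of the Poisson algebra `𝒫`: an `ℝ`-linear map that is a derivation of the
commutative product and of the Poisson bracket. These are the 1-cocycles of `𝒫`. -/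
structure IsPoissonDerivation (π : PoissonStructure V M) (e : ExponentialMap V W ι F E)
    (X : affineFunctions W F E →ₗ[ℝ] affineFunctions W F E) : Prop where
  leibniz : ∀ φ χ, X (affineMul φ χ) = affineMul (X φ) χ + affineMul φ (X χ)
  bracket : ∀ φ χ,
    X (affineBracket π e φ χ) = affineBracket π e (X φ) χ + affineBracket π e φ (X χ)

/-- The first cohomology of the Poisson algebra `𝒫`, that is, the Poisson derivations modulo the
Hamiltonian derivations `{φ, ·}^aff`, is trivial. -/
def InfinitesimalFirstCohomologyTrivial (π : PoissonStructure V M) (e : ExponentialMap V W ι F E) :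
    Prop :=
  ∀ X : affineFunctions W F E →ₗ[ℝ] affineFunctions W F E, IsPoissonDerivation π e X →
    ∃ φ : affineFunctions W F E, ∀ χ, X χ = affineBracket π e φ χ

end InfinitesimalPoissonAlgebra

end PoissonGeometry

end

noncomputable section

set_option linter.unusedSectionVars false

namespace PoissonGeometry

/-! ### Lie algebras with nondegenerate Killing form -/

section LieAlgebra

variable {𝔤 : Type*} [LieRing 𝔤] [LieAlgebra ℝ 𝔤]

/-! Let `L ⊂ 𝒫` be the fiberwise linear functions, that is, the sections of `E*`. They form an ideal
for the product and for the bracket, with `L · L = 0`. The quotient `𝒫 / L` is the Poisson algebra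
`C^∞(S)`, and on `L` the bracket is the pointwise Lie bracket of the conormal fibers. A derivation
`X` is reduced to zero by subtracting two Hamiltonian derivations.

Base directions. From `η · η = 0` for `η` in `L` it follows that `X` preserves `L`
(`IsPoissonDerivation.isFiberwiseLinear`), so `X` induces a derivation of `C^∞(S)`. By Hadamard's
lemma this is a vector field. It respects the bracket of `ψ`, hence is Hamiltonian with some `h`,
and `X - {h, ·}` takes values in `L`.

Fiber directions. A derivation with values in `L` is `C^∞(S)`-linear on `L`, because `X(f) · η` lies
in `L · L = 0`. It is therefore a family of derivations `D` of the fibers, which are copies of `𝔤`.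
The Killing form is nondegenerate, so `D = [z, ·]` for a `z` that is unique because the centre is
zero. Smooth dependence of `z` on the point comes from the Casimir identity `∑ [a_i, [b_i, z]] = z`
(`exists_casimir`), which gives `z = -∑ [a_i, D b_i]`. Uniqueness glues the local solutions to a
section `ζ` (`IsPoissonDerivation.exists_inner`), and `{ζ, ·}` is subtracted.

Remainder. Now `X` vanishes on `L` and has values in `L`. For `η` in `L` and any `φ`, `0 = X{φ, η} =
{Xφ, η}`. So `Xφ` is central in every fiber and vanishes.

The algebraic laws of `𝒫` are inherited from functions near `S`: `𝒫` is their quotient by the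
functions vanishing to second order along `S`. Bracketing preserves those functions because
Hamiltonian vector fields are tangent to a Poisson submanifold
(`IsPoissonSubmanifold.differential_bracket_eq_zero`). -/

theorem IsSemisimpleOfCompactType.isKilling (h : IsSemisimpleOfCompactType 𝔤) :
    LieAlgebra.IsKilling ℝ 𝔤 := by
  refine ⟨(LieSubmodule.eq_bot_iff _).2 fun a ha => ?_⟩
  by_contra h0
  -- An element of the radical is orthogonal to itself, against definiteness.
  have h1 := (LieIdeal.mem_killingCompl ℝ 𝔤 ⊤).1 ha a (LieSubmodule.mem_top a)
  exact (h.2 a h0).ne h1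

variable [FiniteDimensional ℝ 𝔤] [LieAlgebra.IsKilling ℝ 𝔤]

/-- The Casimir element of the Killing form acts as the identity on the adjoint representation. -/
theorem exists_casimir (𝔤 : Type*) [LieRing 𝔤] [LieAlgebra ℝ 𝔤] [FiniteDimensional ℝ 𝔤]
    [LieAlgebra.IsKilling ℝ 𝔤] : ∃ (n : ℕ) (a b : Fin n → 𝔤), ∀ x : 𝔤, ∑ i, ⁅a i, ⁅b i, x⁆⁆ = x := by
  have hnd : (killingForm ℝ 𝔤).Nondegenerate := LieAlgebra.IsKilling.killingForm_nondegenerate ℝ 𝔤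
  have hsymm : LinearMap.IsSymm (killingForm ℝ 𝔤) := LieModule.traceForm_isSymm ℝ 𝔤 𝔤
  set b := Module.finBasis ℝ 𝔤
  set b' := LinearMap.BilinForm.dualBasis (killingForm ℝ 𝔤) hnd b with hb'
  refine ⟨_, b, b', fun x => ?_⟩
  refine sub_eq_zero.1 (hnd.1 _ fun y => ?_)
  have hrepr : ∀ (z : 𝔤) i, b'.repr z i = killingForm ℝ 𝔤 z (b i) := fun z i => by
    rw [hb', LinearMap.BilinForm.dualBasis_repr_apply]
  -- Invariance of the form turns each term of the Casimir sum into a diagonal entry of `ad y ∘ ad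
  -- x` in the dual basis. The sum is then the trace, which is the Killing form of `y` and `x`.
  have h1 : ∀ i, killingForm ℝ 𝔤 ⁅b i, ⁅b' i, x⁆⁆ y
      = b'.repr ((LieAlgebra.ad ℝ 𝔤 y * LieAlgebra.ad ℝ 𝔤 x) (b' i)) i := fun i => by
    have h2 : (LieAlgebra.ad ℝ 𝔤 y * LieAlgebra.ad ℝ 𝔤 x) (b' i) = ⁅⁅b' i, x⁆, y⁆ := by
      rw [← lie_skew ⁅b' i, x⁆ y, ← lie_neg, lie_skew]
      rfl
    rw [hrepr, h2]
    exact (LieModule.traceForm_apply_lie_apply ℝ 𝔤 𝔤 _ _ _).trans (hsymm.eq _ _)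
  rw [map_sub, LinearMap.sub_apply, map_sum, LinearMap.sum_apply, sub_eq_zero]
  simp only [h1]
  rw [show killingForm ℝ 𝔤 x y = killingForm ℝ 𝔤 y x from hsymm.eq x y, killingForm_apply_apply]
  change _ = LinearMap.trace ℝ 𝔤 (LieAlgebra.ad ℝ 𝔤 y * LieAlgebra.ad ℝ 𝔤 x)
  rw [LinearMap.trace_eq_matrix_trace ℝ b']
  simp [Matrix.trace, LinearMap.toMatrix_apply]

/-- For central `x` every term of the Casimir sum vanishes, and the sum is `x`. This yields both the
uniqueness used for gluing and the final vanishing. -/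
theorem eq_zero_of_forall_lie_eq_zero {x : 𝔤} (h : ∀ y : 𝔤, ⁅x, y⁆ = 0) : x = 0 := by
  obtain ⟨n, a, b, hab⟩ := exists_casimir 𝔤
  rw [← hab x]
  refine Finset.sum_eq_zero fun i _ => ?_
  rw [← lie_skew (b i), h, neg_zero, lie_zero]

/-- A derivation of a Lie algebra with nondegenerate Killing form is inner. -/
theorem exists_eq_lie_of_derivation (D : 𝔤 →ₗ[ℝ] 𝔤) (hD : ∀ x y, D ⁅x, y⁆ = ⁅D x, y⁆ + ⁅x, D y⁆) :
    ∃ z : 𝔤, ∀ x, D x = ⁅z, x⁆ := by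
  obtain ⟨z, hz⟩ := LieDerivation.IsKilling.exists_eq_ad
    (⟨D, fun x y => by rw [hD, ← lie_skew y (D x)]; abel⟩ : LieDerivation ℝ 𝔤 𝔤)
  exact ⟨z, fun x => by
    simpa using (congrArg (fun D' : LieDerivation ℝ 𝔤 𝔤 => D' x) hz).symm⟩

end LieAlgebra

/-! ### Hadamard's lemma -/

section Hadamard

universe u

/-- Differentiation under the integral sign, by induction on the order. The target `G` is
generalized because the derivative takes values in `H →L[ℝ] G`; the common universe of `H` and `G`
keeps that space admissible in the induction. -/
theorem contDiff_intervalIntegral {H : Type u} [NormedAddCommGroup H] [NormedSpace ℝ H]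
    [FiniteDimensional ℝ H] (n : ℕ) : ∀ {G : Type u} [NormedAddCommGroup G] [NormedSpace ℝ G]
    [CompleteSpace G] {f : H × ℝ → G}, ContDiff ℝ ∞ f →
    ContDiff ℝ n (fun y => ∫ t in (0 : ℝ)..1, f (y, t)) := by
  induction n with
  | zero =>
    intro G _ _ _ f hf
    refine contDiff_zero.2 ?_
    exact intervalIntegral.continuous_parametric_intervalIntegral_of_continuous'
      (f := fun y t => f (y, t)) hf.continuous 0 1
  | succ n ih =>
    intro G _ _ _ f hf
    have hf' : ContDiff ℝ ∞ (fun p : H × ℝ => (fderiv ℝ f p).comp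
        (ContinuousLinearMap.inl ℝ H ℝ)) :=
      (hf.fderiv_right (m := ∞) (by simp)).clm_comp contDiff_const
    refine contDiff_succ_iff_hasFDerivAt.2 ⟨_, ih hf', fun y₀ => ?_⟩
    -- Compactness of the unit ball around `y₀` times `[0, 1]` supplies a constant dominating
    -- function.
    obtain ⟨C, hC⟩ := ((isCompact_closedBall y₀ (1 : ℝ)).prod
      (isCompact_Icc (a := (0 : ℝ)) (b := 1))).exists_bound_of_continuousOn hf'.continuous.continuousOn
    refine intervalIntegral.hasFDerivAt_integral_of_dominated_of_fderiv_le
      (F := fun y t => f (y, t))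
      (F' := fun y t => (fderiv ℝ f (y, t)).comp (ContinuousLinearMap.inl ℝ H ℝ))
      (bound := fun _ => C)
      (Metric.ball_mem_nhds y₀ one_pos) (Eventually.of_forall fun y => ?_) ?_ ?_ ?_ ?_ ?_
    · exact (hf.continuous.comp (by fun_prop : Continuous fun t : ℝ => (y, t))).aestronglyMeasurable
    · exact (hf.continuous.comp
        (by fun_prop : Continuous fun t : ℝ => (y₀, t))).intervalIntegrable _ _
    · exact (hf'.continuous.comp
        (by fun_prop : Continuous fun t : ℝ => (y₀, t))).aestronglyMeasurable
    · refine Eventually.of_forall fun t ht y hy => hC (y, t) ⟨Metric.ball_subset_closedBall hy, ?_⟩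
      rw [uIoc_of_le zero_le_one] at ht
      exact Ioc_subset_Icc_self ht
    · exact intervalIntegrable_const
    · refine Eventually.of_forall fun t ht y hy => ?_
      exact (hf.differentiable (by simp) (y, t)).hasFDerivAt.comp y (hasFDerivAt_prodMk_left y t)

/-- **Hadamard's lemma**. -/
theorem exists_eq_add_apply_sub {H : Type u} [NormedAddCommGroup H] [NormedSpace ℝ H]
    [FiniteDimensional ℝ H] {f : H → ℝ} (hf : ContDiff ℝ ∞ f) (x : H) :
    ∃ g : H → H →L[ℝ] ℝ, ContDiff ℝ ∞ g ∧ g x = fderiv ℝ f x ∧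
      ∀ y, f y = f x + g y (y - x) := by
  have hF : ContDiff ℝ ∞ (fun p : H × ℝ => fderiv ℝ f (x + p.2 • (p.1 - x))) :=
    (hf.fderiv_right (m := ∞) (by simp)).comp (by fun_prop)
  -- The witness is the average of the derivative over the segment from `x` to `y`; the fundamental
  -- theorem of calculus on this segment gives the identity.
  refine ⟨fun y => ∫ t in (0 : ℝ)..1, fderiv ℝ f (x + t • (y - x)),
    contDiff_infty.2 fun n => contDiff_intervalIntegral n hF, by simp, fun y => ?_⟩
  have hcont : Continuous fun t : ℝ => fderiv ℝ f (x + t • (y - x)) :=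
    hF.continuous.comp (by fun_prop : Continuous fun t : ℝ => (y, t))
  rw [ContinuousLinearMap.intervalIntegral_apply (hcont.intervalIntegrable _ _)]
  have hd : ∀ t ∈ uIcc (0 : ℝ) 1, HasDerivAt (fun t : ℝ => f (x + t • (y - x)))
      (fderiv ℝ f (x + t • (y - x)) (y - x)) t := fun t _ => by
    refine (hf.differentiable (by simp) _).hasFDerivAt.comp_hasDerivAt t ?_
    simpa using ((hasDerivAt_id t).smul_const (y - x)).const_add x
  rw [intervalIntegral.integral_eq_sub_of_hasDerivAt hd
    ((hcont.clm_apply continuous_const).intervalIntegrable _ _)]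
  simp

end Hadamard

/-! ### Derivations of `C^∞(M)` are vector fields -/

section ChartDifferential

variable {V : Type*} [NormedAddCommGroup V] [NormedSpace ℝ V]
  {M : Type*} [TopologicalSpace M] [ChartedSpace V M] [IsManifold 𝓘(ℝ, V) ∞ M]

/-- By the chain rule `g` may be replaced by its linearization at the base point, and for a linear
form the claim is `differential_chartLinear`. -/
theorem differential_comp_extChartAt {p : M} {g : V → ℝ}
    (hg : DifferentiableAt ℝ g (extChartAt 𝓘(ℝ, V) p p)) :
    differential V (fun q => g (extChartAt 𝓘(ℝ, V) p q)) p
      = fderiv ℝ g (extChartAt 𝓘(ℝ, V) p p) := by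
  have h1 := mfderiv_comp (I'' := 𝓘(ℝ, ℝ)) p hg.mdifferentiableAt
    (mdifferentiableAt_extChartAt (I := 𝓘(ℝ, V)) (mem_chart_source V p))
  have h2 := mfderiv_comp (I'' := 𝓘(ℝ, ℝ)) p
    (fderiv ℝ g (extChartAt 𝓘(ℝ, V) p p)).differentiableAt.mdifferentiableAt
    (mdifferentiableAt_extChartAt (I := 𝓘(ℝ, V)) (mem_chart_source V p))
  rw [mfderiv_eq_fderiv] at h1 h2
  rw [ContinuousLinearMap.fderiv] at h2
  exact h1.trans (h2.symm.trans (differential_chartLinear _))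

end ChartDifferential

section Derivations

variable {V : Type*} [NormedAddCommGroup V] [NormedSpace ℝ V] [FiniteDimensional ℝ V]
  {M : Type*} [TopologicalSpace M] [ChartedSpace V M] [IsManifold 𝓘(ℝ, V) ∞ M] [T2Space M]

/-- A smooth bump function with support in a given neighborhood. -/
theorem exists_bump {p : M} {U : Set M} (hU : U ∈ 𝓝 p) :
    ∃ b : C^∞⟮𝓘(ℝ, V), M; 𝓘(ℝ, ℝ), ℝ⟯, ⇑b =ᶠ[𝓝 p] (fun _ => 1) ∧ tsupport b ⊆ U := by
  obtain ⟨b, -, hb⟩ := (SmoothBumpFunction.nhds_basis_tsupport (I := 𝓘(ℝ, V)) p).mem_iff.1 hU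
  exact ⟨⟨b, b.contMDiff⟩, b.eventuallyEq_one, hb⟩

theorem exists_smooth_extension_chart {g : V → ℝ} (hg : ContDiff ℝ ∞ g) (p : M) :
    ∃ h : C^∞⟮𝓘(ℝ, V), M; 𝓘(ℝ, ℝ), ℝ⟯, ⇑h =ᶠ[𝓝 p] fun q => g (extChartAt 𝓘(ℝ, V) p q) :=
  exists_smooth_extension (isOpen_extChartAt_source (I := 𝓘(ℝ, V)) p)
    (fun q hq => ((hg.contMDiff.contMDiffAt (x := extChartAt 𝓘(ℝ, V) p q)).comp q
      (contMDiffAt_extChartAt' (by simpa [extChartAt_source] using hq))).contMDiffWithinAt)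
    (mem_extChartAt_source p)

/-- A point derivation is local and kills constants. Hadamard's lemma writes `f = f p + ∑ u_i w_i`
near `p` with centred coordinates `u_i` and `w_i p = ∂_i f`, so the Leibniz rule leaves `D f = ∑ ∂_i
f · D u_i`. -/
theorem exists_tangent_of_pointDerivation (p : M)
    (D : C^∞⟮𝓘(ℝ, V), M; 𝓘(ℝ, ℝ), ℝ⟯ →ₗ[ℝ] ℝ) (hD : ∀ f g, D (f * g) = f p * D g + g p * D f) :
    ∃ v : TangentSpace 𝓘(ℝ, V) p, ∀ f, D f = differential V f p v := by
  have hlocal : ∀ f g : C^∞⟮𝓘(ℝ, V), M; 𝓘(ℝ, ℝ), ℝ⟯, ⇑f =ᶠ[𝓝 p] g → D f = D g := by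
    intro f g hfg
    -- The bump function lives where `f = g`, so `b * (f - g) = 0`; it equals `1` at `p`, so the
    -- Leibniz rule isolates `D (f - g)`.
    obtain ⟨b, hb1, hb⟩ := exists_bump (V := V) hfg
    have h0 : b * (f - g) = 0 := by
      ext q
      change b q * (f q - g q) = 0
      by_cases hq : b q = 0
      · rw [hq, zero_mul]
      · rw [sub_eq_zero.2 (hb (subset_tsupport _ hq)), mul_zero]
    have h1 := hD b (f - g)
    have h2 : (f - g) p = 0 := sub_eq_zero.2 hfg.self_of_nhds
    rw [h0, map_zero, h2, hb1.self_of_nhds, map_sub] at h1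
    linarith
  have hone : D 1 = 0 := by
    have h := hD 1 1
    have h1 : (1 : C^∞⟮𝓘(ℝ, V), M; 𝓘(ℝ, ℝ), ℝ⟯) p = 1 := rfl
    rw [mul_one, h1] at h
    linarith
  set c := extChartAt 𝓘(ℝ, V) p
  set b := Module.finBasis ℝ V
  choose u hu using fun i => exists_smooth_extension_chart (g := fun z => b.coord i (z - c p))
    (((b.coord i).toContinuousLinearMap.contDiff).comp (contDiff_id.sub contDiff_const)) p
  refine ⟨∑ i, D (u i) • b i, fun f => ?_⟩
  -- In the chart `f` is smooth only on the target; Hadamard's lemma is applied to a function on all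
  -- of `V` with the same germ.
  obtain ⟨g, hg⟩ := exists_smooth_extension (V := V) (M := V) (isOpen_extChartAt_target p)
    (f.contMDiff.comp_contMDiffOn (contMDiffOn_extChartAt_symm (n := ∞) p))
    (mem_extChartAt_target p)
  have hfg : ⇑f =ᶠ[𝓝 p] fun q => g (c q) := by
    filter_upwards [(continuousAt_extChartAt (I := 𝓘(ℝ, V)) p).eventually hg,
      extChartAt_source_mem_nhds (I := 𝓘(ℝ, V)) p] with q hq hqs
    exact (congrArg f (c.left_inv hqs)).symm.trans hq.symm
  have hgs : ContDiff ℝ ∞ g := g.contMDiff.contDiff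
  obtain ⟨k, hk, hkp, hkg⟩ := exists_eq_add_apply_sub hgs (c p)
  choose w hw using fun i =>
    exists_smooth_extension_chart (hk.clm_apply (contDiff_const (c := b i))) p
  have hdec : D f = D (f p • 1 + ∑ i, u i * w i) := by
    refine hlocal _ _ ?_
    filter_upwards [hfg, eventually_all.2 hu, eventually_all.2 hw] with q h1 h2 h3
    have h4 : (f p • 1 + ∑ i, u i * w i : C^∞⟮𝓘(ℝ, V), M; 𝓘(ℝ, ℝ), ℝ⟯) q
        = f p + ∑ i, u i q * w i q := by
      change f p * 1 + (∑ i, u i * w i : C^∞⟮𝓘(ℝ, V), M; 𝓘(ℝ, ℝ), ℝ⟯) q = _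
      rw [mul_one]
      congr 1
      have := map_sum (ContMDiffMap.evalRingHom (I := 𝓘(ℝ, V)) (n := ∞) q) (fun i => u i * w i) Finset.univ
      exact this
    rw [h4, h1, hkg, hfg.self_of_nhds]
    congr 1
    conv_lhs => rw [← b.sum_repr (c q - c p), map_sum]
    refine Finset.sum_congr rfl fun i _ => ?_
    rw [h2, h3, map_smul]
    rfl
  have hup : ∀ i, u i p = 0 := fun i => by
    rw [(hu i).self_of_nhds]
    exact (congrArg (b.coord i) (sub_self (c p))).trans (map_zero _)
  have hdf : differential V f p = fderiv ℝ g (c p) :=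
    hfg.mfderiv_eq.trans (differential_comp_extChartAt (hgs.differentiable (by simp) _))
  rw [hdec, hdf, map_add, map_smul, hone, smul_zero, zero_add, map_sum]
  refine Eq.trans ?_ (map_sum (fderiv ℝ g (c p)) _ _).symm
  refine Finset.sum_congr rfl fun i _ => ?_
  have h1 : w i p = fderiv ℝ g (c p) (b i) := (hw i).self_of_nhds.trans (congrArg (· (b i)) hkp)
  rw [hD, hup, h1, map_smul, smul_eq_mul]
  ring

/-- Pointwise, `δ` gives tangent vectors `Y p`. Their coordinates near a point are the smooth
functions `δ (u i)`, where `u i` is a global function that agrees with the `i`-th coordinate near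
that point. -/
theorem exists_vectorField_of_derivation
    (δ : C^∞⟮𝓘(ℝ, V), M; 𝓘(ℝ, ℝ), ℝ⟯ →ₗ[ℝ] C^∞⟮𝓘(ℝ, V), M; 𝓘(ℝ, ℝ), ℝ⟯)
    (hδ : ∀ f g, δ (f * g) = f * δ g + g * δ f) :
    ∃ Y : ∀ p : M, TangentSpace 𝓘(ℝ, V) p,
      ContMDiff 𝓘(ℝ, V) 𝓘(ℝ, V).tangent ∞ (fun p => (⟨p, Y p⟩ : TangentBundle 𝓘(ℝ, V) M)) ∧
      ∀ f p, δ f p = differential V f p (Y p) := by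
  have hY : ∀ p : M, ∃ v : TangentSpace 𝓘(ℝ, V) p, ∀ f, δ f p = differential V f p v := fun p =>
    exists_tangent_of_pointDerivation p
      { toFun := fun f => δ f p
        map_add' := fun f g => by rw [map_add]; rfl
        map_smul' := fun r f => by rw [map_smul]; rfl }
      fun f g => by
        change (δ (f * g)) p = _
        rw [hδ]
        rfl
  choose Y hY using hY
  refine ⟨Y, fun p => ?_, fun f p => hY p f⟩
  refine (Bundle.contMDiffAt_totalSpace (F := V)).2 ⟨contMDiffAt_id, ?_⟩
  set b := Module.finBasis ℝ V
  choose u hu using fun i => exists_smooth_extension_chart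
    (b.coord i).toContinuousLinearMap.contDiff p
  have hsm : ContMDiffAt 𝓘(ℝ, V) 𝓘(ℝ, V) ∞ (fun q => ∑ i, δ (u i) q • b i) p :=
    ContMDiffAt.sum fun i _ => ((δ (u i)).contMDiff.contMDiffAt).smul contMDiffAt_const
  refine hsm.congr_of_eventuallyEq ?_
  filter_upwards [eventually_all.2 fun i => (hu i).eventuallyEq_nhds,
    extChartAt_source_mem_nhds (I := 𝓘(ℝ, V)) p] with q hq hqs
  have hqs' : q ∈ (chartAt V p).source := by simpa [extChartAt_source] using hqs
  have h1 : ∀ i, δ (u i) q = b.coord i (mfderiv 𝓘(ℝ, V) 𝓘(ℝ, V) (extChartAt 𝓘(ℝ, V) p) q (Y q)) := by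
    intro i
    rw [hY]
    have h2 := mfderiv_comp (I'' := 𝓘(ℝ, ℝ)) q
      (b.coord i).toContinuousLinearMap.differentiableAt.mdifferentiableAt
      (mdifferentiableAt_extChartAt (I := 𝓘(ℝ, V)) hqs')
    rw [mfderiv_eq_fderiv, ContinuousLinearMap.fderiv] at h2
    have h3 := (hq i).mfderiv_eq (I := 𝓘(ℝ, V)) (I' := 𝓘(ℝ, ℝ))
    exact congrArg (fun L => L (Y q)) (h3.trans h2)
  simp only [h1]
  refine Eq.trans ?_ (b.sum_repr (mfderiv 𝓘(ℝ, V) 𝓘(ℝ, V) (extChartAt 𝓘(ℝ, V) p) q (Y q))).symm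
  exact congrArg (· (Y q)) (mfderiv_chartAt_eq_tangentCoordChange hqs').symm

end Derivations

/-! ### Poisson brackets of locally defined functions -/

section LocalBracket

variable {V : Type*} [NormedAddCommGroup V] [NormedSpace ℝ V]
  {M : Type*} [TopologicalSpace M] [ChartedSpace V M]

theorem differential_add {f g : M → ℝ} {p : M} (hf : MDifferentiableAt 𝓘(ℝ, V) 𝓘(ℝ, ℝ) f p)
    (hg : MDifferentiableAt 𝓘(ℝ, V) 𝓘(ℝ, ℝ) g p) :
    differential V (fun q => f q + g q) p = differential V f p + differential V g p :=
  mfderiv_add hf hg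

theorem differential_sub {f g : M → ℝ} {p : M} (hf : MDifferentiableAt 𝓘(ℝ, V) 𝓘(ℝ, ℝ) f p)
    (hg : MDifferentiableAt 𝓘(ℝ, V) 𝓘(ℝ, ℝ) g p) :
    differential V (fun q => f q - g q) p = differential V f p - differential V g p :=
  mfderiv_sub hf hg

theorem differential_mul {f g : M → ℝ} {p : M} (hf : MDifferentiableAt 𝓘(ℝ, V) 𝓘(ℝ, ℝ) f p)
    (hg : MDifferentiableAt 𝓘(ℝ, V) 𝓘(ℝ, ℝ) g p) :
    differential V (fun q => f q * g q) p = f p • differential V g p + g p • differential V f p :=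
  (hf.hasMFDerivAt.mul hg.hasMFDerivAt).mfderiv

theorem differential_const_mul {f : M → ℝ} {p : M} (r : ℝ)
    (hf : MDifferentiableAt 𝓘(ℝ, V) 𝓘(ℝ, ℝ) f p) :
    differential V (fun q => r * f q) p = r • differential V f p :=
  (hf.hasMFDerivAt.const_smul r).mfderiv

theorem PoissonStructure.bivector_skew (π : PoissonStructure V M) (p : M) (α β : Cotangent V p) :
    π.bivector p α β = -π.bivector p β α := by
  have h := π.alternating p (α + β)
  simp only [map_add, LinearMap.add_apply, π.alternating, zero_add, add_zero] at h
  linarith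

theorem PoissonStructure.bracket_skew (π : PoissonStructure V M) (f g : M → ℝ) (p : M) :
    π.bracket f g p = -π.bracket g f p :=
  π.bivector_skew p _ _

theorem PoissonStructure.bracket_congr (π : PoissonStructure V M) {f f' g g' : M → ℝ} {p : M}
    (hf : f =ᶠ[𝓝 p] f') (hg : g =ᶠ[𝓝 p] g') : π.bracket f g =ᶠ[𝓝 p] π.bracket f' g' := by
  filter_upwards [hf.eventuallyEq_nhds, hg.eventuallyEq_nhds] with q hq hq'
  simp only [PoissonStructure.bracket, differential, hq.mfderiv_eq, hq'.mfderiv_eq]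

variable [FiniteDimensional ℝ V] [IsManifold 𝓘(ℝ, V) ∞ M] [T2Space M]

theorem PoissonStructure.contMDiffOn_bracket (π : PoissonStructure V M) {f g : M → ℝ} {U : Set M}
    (hU : IsOpen U) (hf : ContMDiffOn 𝓘(ℝ, V) 𝓘(ℝ, ℝ) ∞ f U)
    (hg : ContMDiffOn 𝓘(ℝ, V) 𝓘(ℝ, ℝ) ∞ g U) :
    ContMDiffOn 𝓘(ℝ, V) 𝓘(ℝ, ℝ) ∞ (π.bracket f g) U :=
  fun _ hp => (π.contMDiffAt_bracket hU hf hg hp).contMDiffWithinAt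

/-- The identity is an axiom for global functions only; brackets depend on germs, so the arguments
may be replaced by global extensions. -/
theorem PoissonStructure.jacobi_of_contMDiffOn (π : PoissonStructure V M) {f g h : M → ℝ}
    {U : Set M} (hU : IsOpen U) (hf : ContMDiffOn 𝓘(ℝ, V) 𝓘(ℝ, ℝ) ∞ f U)
    (hg : ContMDiffOn 𝓘(ℝ, V) 𝓘(ℝ, ℝ) ∞ g U) (hh : ContMDiffOn 𝓘(ℝ, V) 𝓘(ℝ, ℝ) ∞ h U)
    {p : M} (hp : p ∈ U) :
    π.bracket f (π.bracket g h) p + π.bracket g (π.bracket h f) p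
      + π.bracket h (π.bracket f g) p = 0 := by
  obtain ⟨f', hf'⟩ := exists_smooth_extension hU hf hp
  obtain ⟨g', hg'⟩ := exists_smooth_extension hU hg hp
  obtain ⟨h', hh'⟩ := exists_smooth_extension hU hh hp
  rw [← (π.bracket_congr hf' (π.bracket_congr hg' hh')).self_of_nhds,
    ← (π.bracket_congr hg' (π.bracket_congr hh' hf')).self_of_nhds,
    ← (π.bracket_congr hh' (π.bracket_congr hf' hg')).self_of_nhds]
  exact π.jacobi f' g' h' p

variable {W : Type*} [NormedAddCommGroup W] [NormedSpace ℝ W]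
  {S : Type*} [TopologicalSpace S] [ChartedSpace W S]
  {ψ : PoissonStructure W S} {π : PoissonStructure V M} {ι : S → M}

/-- Bracketing preserves the functions that vanish to second order along a Poisson submanifold. -/
theorem IsPoissonSubmanifold.differential_bracket_eq_zero (hS : IsPoissonSubmanifold ψ π ι)
    (hι : ContMDiff 𝓘(ℝ, W) 𝓘(ℝ, V) ∞ ι) {f R : M → ℝ} {U : Set M} (hU : IsOpen U)
    (hf : ContMDiffOn 𝓘(ℝ, V) 𝓘(ℝ, ℝ) ∞ f U) (hR : ContMDiffOn 𝓘(ℝ, V) 𝓘(ℝ, ℝ) ∞ R U)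
    {x : S} (hx : ι x ∈ U) (hR0 : ∀ x, differential V R (ι x) = 0) :
    differential V (π.bracket f R) (ι x) = 0 := by
  set p := ι x with hp
  set c := extChartAt 𝓘(ℝ, V) p with hc
  set b := Module.finBasis ℝ V
  have hO : IsOpen (U ∩ c.source) := hU.inter (isOpen_extChartAt_source p)
  have hpO : p ∈ U ∩ c.source := ⟨hx, mem_extChartAt_source p⟩
  set y : Fin (Module.finrank ℝ V) → M → ℝ :=
    fun i r => (b.coord i).toContinuousLinearMap (c r) with hy
  have hysm : ∀ i, ContMDiffOn 𝓘(ℝ, V) 𝓘(ℝ, ℝ) ∞ (y i) (U ∩ c.source) := fun i q hq => by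
    refine ContMDiffAt.contMDiffWithinAt ?_
    exact ((b.coord i).toContinuousLinearMap.contMDiff (n := ∞)).contMDiffAt.comp q
      (contMDiffAt_extChartAt' (by simpa [c, extChartAt_source] using hq.2))
  set R' : V → ℝ := R ∘ c.symm with hR'
  have hRs : ContDiffAt ℝ ∞ R' (c p) := by
    refine ContMDiffAt.contDiffAt (ContMDiffAt.comp (c p) ?_
      (contMDiffOn_extChartAt_symm (n := ∞) p |>.contMDiffAt (extChartAt_target_mem_nhds p)))
    rw [extChartAt_to_inv]
    exact hR.contMDiffAt (hU.mem_nhds hx)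
  have hk : ContDiffAt ℝ ∞ (fderiv ℝ R') (c p) := hRs.fderiv_right (m := ∞) (by simp)
  have hkd : DifferentiableAt ℝ (fderiv ℝ R') (c p) := hk.differentiableAt (by simp)
  set a : Fin (Module.finrank ℝ V) → M → ℝ := fun i q => fderiv ℝ R' (c q) (b i) with ha
  -- In coordinates `{f, R} = ∑ ∂_i R · {f, y_i}`.
  have hsum : π.bracket f R =ᶠ[𝓝 p] fun q => ∑ i, a i q * π.bracket f (y i) q := by
    filter_upwards [hO.mem_nhds hpO] with q hq
    simp only [PoissonStructure.bracket]
    rw [differential_eq_sum hq.2 (hR.contMDiffAt (hU.mem_nhds hq.1))]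
    simp only [map_sum, map_smul, smul_eq_mul]
    rfl
  have hR'0 : ∀ x', ι x' ∈ U ∩ c.source → fderiv ℝ R' (c (ι x')) = 0 := fun x' hx' => by
    have h2 : MDifferentiableAt 𝓘(ℝ, V) 𝓘(ℝ, V) c.symm (c (ι x')) :=
      (contMDiffOn_extChartAt_symm (n := ∞) p |>.contMDiffAt
        (extChartAt_target_mem_nhds' (c.map_source hx'.2))).mdifferentiableAt (by simp)
    have h1 : MDifferentiableAt 𝓘(ℝ, V) 𝓘(ℝ, ℝ) R (c.symm (c (ι x'))) := by
      rw [c.left_inv hx'.2]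
      exact (hR.contMDiffAt (hU.mem_nhds hx'.1)).mdifferentiableAt (by simp)
    have h3 := mfderiv_comp (c (ι x')) h1 h2
    have h4 : ∀ r : M, r = ι x' → ∀ u, mfderiv 𝓘(ℝ, V) 𝓘(ℝ, ℝ) R r u = 0 := by
      rintro r rfl u
      exact congrArg (fun L => L u) (hR0 x')
    rw [mfderiv_eq_fderiv] at h3
    ext u
    exact (congrArg (fun L => L u) h3).trans (h4 _ (c.left_inv hx'.2) _)
  have hfd : ∀ u, differential V (fun q => fderiv ℝ R' (c q) u) p
      = (fderiv ℝ (fderiv ℝ R') (c p)).flip u := fun u => by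
    have h1 := (hkd.hasFDerivAt.clm_apply (hasFDerivAt_const u (c p))).fderiv
    have h2 := differential_comp_extChartAt (p := p) (g := fun z => fderiv ℝ R' z u)
      (hkd.clm_apply (differentiableAt_const _))
    rw [ContinuousLinearMap.comp_zero, zero_add] at h1
    exact h2.trans h1
  have hBd : ∀ i, MDifferentiableAt 𝓘(ℝ, V) 𝓘(ℝ, ℝ) (π.bracket f (y i)) p := fun i =>
    (π.contMDiffAt_bracket hO (hf.mono inter_subset_left) (hysm i) hpO).mdifferentiableAt (by simp)
  have had : ∀ u, MDifferentiableAt 𝓘(ℝ, V) 𝓘(ℝ, ℝ) (fun q => fderiv ℝ R' (c q) u) p := fun u =>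
    (ContMDiffAt.comp p (hk.clm_apply contDiffAt_const).contMDiffAt
      contMDiffAt_extChartAt).mdifferentiableAt (by simp)
  -- The partial derivatives of `R` vanish at `p`, so only their differentials survive: `d{f, R}` is
  -- the Hessian of `R` contracted with the Hamiltonian vector field of `f`.
  have htot : differential V (π.bracket f R) p
      = ∑ i, π.bracket f (y i) p • differential V (a i) p := by
    have hterm : ∀ i, HasMFDerivAt 𝓘(ℝ, V) 𝓘(ℝ, ℝ) (fun q => a i q * π.bracket f (y i) q) p
        (π.bracket f (y i) p • differential V (a i) p) := fun i => by
      have h : HasMFDerivAt 𝓘(ℝ, V) 𝓘(ℝ, ℝ) (fun q => a i q * π.bracket f (y i) q) p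
          (a i p • differential V (π.bracket f (y i)) p
            + π.bracket f (y i) p • differential V (a i) p) :=
        (had (b i)).hasMFDerivAt.mul (hBd i).hasMFDerivAt
      have h0 : a i p = 0 := by
        change fderiv ℝ R' (c p) (b i) = 0
        rw [hR'0 x hpO]
        rfl
      rwa [h0, zero_smul, zero_add] at h
    have h := HasMFDerivAt.sum (t := Finset.univ) fun i _ => hterm i
    have hfun : (fun q => ∑ i, a i q * π.bracket f (y i) q)
        = ∑ i, fun q => a i q * π.bracket f (y i) q := by
      funext q
      rw [Finset.sum_apply]
    rw [← hfun] at h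
    exact hsum.mfderiv_eq.trans h.mfderiv
  have hsymm := hRs.isSymmSndFDerivAt (by
    rw [minSmoothness_of_isRCLikeNormedField]
    exact WithTop.coe_le_coe.2 (le_top : (2 : ℕ∞) ≤ ⊤))
  set D := fderiv ℝ (fderiv ℝ R') (c p) with hD
  -- All partial derivatives of `R` vanish along `S`, hence the Hessian annihilates directions
  -- tangent to `S`.
  have htan : ∀ w : TangentSpace 𝓘(ℝ, W) x, D (mfderiv 𝓘(ℝ, W) 𝓘(ℝ, V) ι x w) = 0 := fun w => by
    have h1 : (fun x' => fderiv ℝ R' (c (ι x'))) =ᶠ[𝓝 x] fun _ => 0 := by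
      filter_upwards [hι.continuous.continuousAt.preimage_mem_nhds (hO.mem_nhds hpO)] with x' hx'
      exact hR'0 x' hx'
    ext u
    have h2 := mfderiv_comp (I'' := 𝓘(ℝ, ℝ)) x (had u) (hι.mdifferentiableAt (by simp))
    have h3 : (fun q => fderiv ℝ R' (c q) u) ∘ ι =ᶠ[𝓝 x] fun _ => (0 : ℝ) := by
      filter_upwards [h1] with x' hx'
      exact congrArg (fun L => L u) hx'
    rw [h3.mfderiv_eq, mfderiv_const] at h2
    have h4 := (congrArg (fun L => L w) h2).symm
    have h5 := congrArg (fun L => L (mfderiv 𝓘(ℝ, W) 𝓘(ℝ, V) ι x w)) (hfd u)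
    exact h5.symm.trans h4
  have hval : ∀ L : V →L[ℝ] ℝ, ∑ i, π.bracket f (y i) p * L (b i)
      = π.bivector p (differential V f p) L := fun L => by
    have h1 : L = ∑ i, L (b i) • (b.coord i).toContinuousLinearMap := by
      ext v
      conv_lhs => rw [← b.sum_repr v, map_sum]
      rw [sum_apply]
      refine Finset.sum_congr rfl fun i _ => ?_
      rw [map_smul, smul_eq_mul, mul_comm]
      rfl
    have h2 : ∀ i, π.bracket f (y i) p
        = π.bivector p (differential V f p) (b.coord i).toContinuousLinearMap := fun i =>
      congrArg (π.bivector p (differential V f p)) (differential_chartLinear (p := p)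
        (b.coord i).toContinuousLinearMap)
    refine Eq.trans ?_ (congrArg (π.bivector p (differential V f p)) h1.symm)
    refine Eq.trans ?_ (map_sum (π.bivector p (differential V f p)) _ _).symm
    refine Finset.sum_congr rfl fun i _ => ?_
    rw [h2, mul_comm]
    exact (map_smul (π.bivector p (differential V f p)) _ _).symm
  rw [htot]
  ext v
  have h1 : (∑ i, π.bracket f (y i) p • differential V (a i) p) v
      = ∑ i, π.bracket f (y i) p * D v (b i) := by
    rw [sum_apply]
    refine Finset.sum_congr rfl fun i _ => ?_
    rw [hfd]
    rfl
  -- Along `S` the bivector sees covectors only through their restriction to `TS`. By symmetry of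
  -- the Hessian, the covector `D v` restricts to zero there.
  refine h1.trans ((hval (D v)).trans ((hS.poisson x _ _).trans ?_))
  have h2 : ContinuousLinearMap.comp (D v : Cotangent V (ι x)) (mfderiv 𝓘(ℝ, W) 𝓘(ℝ, V) ι x) = 0 := by
    ext w
    refine (hsymm v _).trans ?_
    exact congrArg (fun L => L v) (htan w)
  exact (congrArg _ h2).trans (map_zero _)

end LocalBracket

/-! ### First order jets along a submanifold -/

section Jets

variable {V : Type*} [NormedAddCommGroup V] [NormedSpace ℝ V]
  {M : Type*} [TopologicalSpace M] [ChartedSpace V M]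
  {W : Type*} [NormedAddCommGroup W] [NormedSpace ℝ W]
  {S : Type*} [TopologicalSpace S] [ChartedSpace W S]
  {F : Type*} [NormedAddCommGroup F] [NormedSpace ℝ F]
  {E : S → Type*} [∀ x, AddCommGroup (E x)] [∀ x, Module ℝ (E x)]
  [TopologicalSpace (Bundle.TotalSpace F E)] [∀ x, TopologicalSpace (E x)]
  [FiberBundle F E] [VectorBundle ℝ F E]
  {ι : S → M}

namespace ExponentialMap

/-- The derivative of `e` along the fiber `E_x` at the zero vector. -/
def normalMap (e : ExponentialMap V W ι F E) (x : S) : E x →ₗ[ℝ] TangentSpace 𝓘(ℝ, V) (ι x) :=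
  (mfderiv 𝓘(ℝ, F) 𝓘(ℝ, V)
      (fun u : F => e.toHomeo ⟨x, (trivializationAt F E x).symmL ℝ x u⟩) 0 : F →L[ℝ] V).toLinearMap
    ∘ₗ ((trivializationAt F E x).continuousLinearMapAt ℝ x).toLinearMap

theorem contMDiffAt_fiber (e : ExponentialMap V W ι F E) (x : S) :
    ContMDiffAt 𝓘(ℝ, F) 𝓘(ℝ, V) ∞
      (fun u : F => e.toHomeo ⟨x, (trivializationAt F E x).symmL ℝ x u⟩) 0 := by
  set T := trivializationAt F E x with hT
  have hx : x ∈ T.baseSet := FiberBundle.mem_baseSet_trivializationAt' x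
  have hj : ContMDiff 𝓘(ℝ, F) (𝓘(ℝ, W).prod 𝓘(ℝ, F)) ∞
      (fun u : F => (⟨x, T.symmL ℝ x u⟩ : Bundle.TotalSpace F E)) := by
    intro u
    rw [Bundle.contMDiffAt_totalSpace]
    refine ⟨contMDiffAt_const, ?_⟩
    have : (fun v : F => (T (⟨x, T.symmL ℝ x v⟩ : Bundle.TotalSpace F E)).2) = fun v => v := by
      funext v
      rw [T.symmL_apply hx]
      exact congrArg Prod.snd (T.apply_mk_symm hx v)
    change ContMDiffAt 𝓘(ℝ, F) 𝓘(ℝ, F) ∞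
      (fun v : F => (T (⟨x, T.symmL ℝ x v⟩ : Bundle.TotalSpace F E)).2) u
    rw [this]
    exact contMDiffAt_id
  refine ContMDiffAt.comp (g := e.toHomeo)
    (f := fun u : F => (⟨x, T.symmL ℝ x u⟩ : Bundle.TotalSpace F E)) 0 ?_ (hj 0)
  rw [_root_.map_zero]
  exact e.smooth.contMDiffAt (e.toHomeo.open_source.mem_nhds (e.zero_mem x))

theorem hasDerivAt_comp_fiberScale (e : ExponentialMap V W ι F E) {f : M → ℝ} (x : S) (v : E x)
    (hf : MDifferentiableAt 𝓘(ℝ, V) 𝓘(ℝ, ℝ) f (ι x)) :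
    HasDerivAt (fun t : ℝ => f (e.toHomeo (fiberScale t (⟨x, v⟩ : Bundle.TotalSpace F E))))
      (differential V f (ι x) (e.normalMap x v)) 0 := by
  set T := trivializationAt F E x with hT
  have hx : x ∈ T.baseSet := FiberBundle.mem_baseSet_trivializationAt' x
  set q : F → M := fun u : F => e.toHomeo ⟨x, T.symmL ℝ x u⟩ with hq
  have hq0 : q 0 = ι x := by
    simp only [hq, _root_.map_zero]
    exact e.map_zero x
  have hqd : MDifferentiableAt 𝓘(ℝ, F) 𝓘(ℝ, V) q 0 :=
    (e.contMDiffAt_fiber x).mdifferentiableAt (by simp)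
  -- Tangent spaces depend on the base point, and `q 0` equals `ι x` only after a rewrite; the
  -- equality is therefore eliminated in a general form.
  have key : ∀ r : M, r = ι x → ∀ u : V,
      mfderiv 𝓘(ℝ, V) 𝓘(ℝ, ℝ) f r u = differential V f (ι x) u := by
    rintro r rfl u
    rfl
  have h1 : MDifferentiableAt 𝓘(ℝ, V) 𝓘(ℝ, ℝ) f (q 0) := by rwa [hq0]
  have h2 := mfderiv_comp (0 : F) h1 hqd
  have h3 : DifferentiableAt ℝ (f ∘ q) 0 := (h1.comp (0 : F) hqd).differentiableAt
  rw [mfderiv_eq_fderiv] at h2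
  have hline : HasDerivAt (fun t : ℝ => t • T.continuousLinearMapAt ℝ x v)
      (T.continuousLinearMapAt ℝ x v) 0 := by
    simpa using (hasDerivAt_id (0 : ℝ)).smul_const (T.continuousLinearMapAt ℝ x v)
  have hcomp := (show HasFDerivAt (f ∘ q) (fderiv ℝ (f ∘ q) 0)
      ((fun t : ℝ => t • T.continuousLinearMapAt ℝ x v) 0) by
        simpa using h3.hasFDerivAt).comp_hasDerivAt (0 : ℝ) hline
  have heq : (fun t : ℝ => f (e.toHomeo (fiberScale t (⟨x, v⟩ : Bundle.TotalSpace F E))))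
      = (f ∘ q) ∘ fun t : ℝ => t • T.continuousLinearMapAt ℝ x v := by
    funext t
    simp only [hq, Function.comp_apply, map_smul, T.symmL_continuousLinearMapAt hx, fiberScale]
  rw [heq]
  have h4 : fderiv ℝ (f ∘ q) 0 (T.continuousLinearMapAt ℝ x v)
      = differential V f (ι x) (e.normalMap x v) :=
    (congrArg (fun L => L (T.continuousLinearMapAt ℝ x v)) h2).trans (key _ hq0 _)
  rw [← h4]
  exact hcomp

theorem contMDiff_base (e : ExponentialMap V W ι F E) : ContMDiff 𝓘(ℝ, W) 𝓘(ℝ, V) ∞ ι := by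
  have h := e.smooth.comp_contMDiff (Bundle.contMDiff_zeroSection ℝ E) e.zero_mem
  exact h.congr fun x => (e.map_zero x).symm

variable [ContMDiffVectorBundle ∞ F E 𝓘(ℝ, W)]

/-- The tangent space of `M` at a point of `S` is spanned by the directions along `S` and the
directions along the fiber of `E`. -/
theorem covector_eq_zero (e : ExponentialMap V W ι F E) {x : S} {α : Cotangent V (ι x)}
    (h1 : ∀ w, α (mfderiv 𝓘(ℝ, W) 𝓘(ℝ, V) ι x w) = 0) (h2 : ∀ v, α (e.normalMap x v) = 0) :
    α = 0 := by
  set T := trivializationAt F E x with hT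
  have hx : x ∈ T.baseSet := FiberBundle.mem_baseSet_trivializationAt' x
  set q : S × F → M := fun z => e.toHomeo (T.toOpenPartialHomeomorph.symm z) with hq
  set r : M → S × F := fun p => T (e.toHomeo.symm p) with hr
  have hT0 : T (⟨x, 0⟩ : Bundle.TotalSpace F E) = (x, 0) := by
    refine Prod.ext (T.coe_fst' hx) ?_
    exact (T.linear ℝ hx).map_zero
  have hT0' : T.toOpenPartialHomeomorph.symm (x, 0) = (⟨x, 0⟩ : Bundle.TotalSpace F E) := by
    rw [← hT0]
    exact T.toOpenPartialHomeomorph.left_inv (T.mem_source.2 hx)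
  have hq0 : q (x, 0) = ι x := by
    simp only [hq]
    rw [hT0', e.map_zero]
  have hsymm0 : e.toHomeo.symm (ι x) = ⟨x, 0⟩ := by
    rw [← e.map_zero, e.toHomeo.left_inv (e.zero_mem x)]
  have hιt : ι x ∈ e.toHomeo.target := by
    rw [← e.map_zero]; exact e.toHomeo.map_source (e.zero_mem x)
  have hr0 : r (ι x) = (x, 0) := by
    simp only [hr]
    rw [hsymm0, hT0]
  have hqs : ContMDiffAt (𝓘(ℝ, W).prod 𝓘(ℝ, F)) 𝓘(ℝ, V) ∞ q (x, 0) := by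
    refine ContMDiffAt.comp (g := e.toHomeo) (x, 0) ?_
      (T.contMDiffOn_symm.contMDiffAt (T.open_target.mem_nhds (T.mem_target.2 hx)))
    rw [hT0']
    exact e.smooth.contMDiffAt (e.toHomeo.open_source.mem_nhds (e.zero_mem x))
  have hrs : ContMDiffAt 𝓘(ℝ, V) (𝓘(ℝ, W).prod 𝓘(ℝ, F)) ∞ r (ι x) := by
    refine ContMDiffAt.comp (g := T) (ι x) ?_
      (e.smooth_symm.contMDiffAt (e.toHomeo.open_target.mem_nhds hιt))
    rw [hsymm0]
    exact T.contMDiffOn.contMDiffAt (T.open_source.mem_nhds (T.mem_source.2 hx))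
  -- In a trivialization `e` has a local right inverse, so its derivative at `(x, 0)` is onto. It
  -- then suffices that `α` vanishes on the image.
  have hqr : q ∘ r =ᶠ[𝓝 (ι x)] id := by
    have hc : ContinuousAt e.toHomeo.symm (ι x) := e.toHomeo.symm.continuousAt hιt
    filter_upwards [e.toHomeo.open_target.mem_nhds hιt, hc.preimage_mem_nhds
      (by rw [hsymm0]; exact T.open_source.mem_nhds (T.mem_source.2 hx))] with p hp hp'
    simp only [hq, hr, Function.comp_apply, id]
    have := T.toOpenPartialHomeomorph.left_inv hp'
    refine (congrArg e.toHomeo this).trans (e.toHomeo.right_inv hp)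
  -- The derivative is the sum of its two partial derivatives: the one along `S` is that of `ι`, the
  -- one along `F` is `normalMap`.
  have hpart : ∀ w : W × F, α ((mfderiv (𝓘(ℝ, W).prod 𝓘(ℝ, F)) 𝓘(ℝ, V) q (x, 0) : W × F →L[ℝ] V) w)
      = 0 := fun w => by
    have h3 := mfderiv_prod_eq_add_apply (v := w) (hqs.mdifferentiableAt (by simp))
    have h4 : (fun z : S => q (z, 0)) =ᶠ[𝓝 x] ι := by
      filter_upwards [T.open_baseSet.mem_nhds hx] with z hz
      simp only [hq]
      rw [← T.mk_symm hz, ← T.symmL_apply (R := ℝ) hz, _root_.map_zero, e.map_zero]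
    have h5 : (fun u : F => q (x, u)) = fun u => e.toHomeo ⟨x, T.symmL ℝ x u⟩ := by
      funext u
      simp only [hq]
      rw [← T.mk_symm hx, ← T.symmL_apply (R := ℝ) hx]
    have h6 : mfderiv 𝓘(ℝ, W) 𝓘(ℝ, V) (fun z : S => q (z, 0)) x = mfderiv 𝓘(ℝ, W) 𝓘(ℝ, V) ι x :=
      h4.mfderiv_eq
    have h7 := h2 (T.symmL ℝ x w.2)
    have h8 : e.normalMap x (T.symmL ℝ x w.2)
        = (mfderiv 𝓘(ℝ, F) 𝓘(ℝ, V) (fun u : F => q (x, u)) 0 : F →L[ℝ] V) w.2 := by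
      rw [h5]
      exact congrArg _ (T.continuousLinearMapAt_symmL hx w.2)
    rw [h8] at h7
    have h9 := h1 w.1
    rw [← h6] at h9
    refine (congrArg (fun u : V => (α : V →L[ℝ] ℝ) u) h3).trans ?_
    refine (_root_.map_add (α : V →L[ℝ] ℝ) _ _).trans ?_
    exact (congrArg₂ (· + ·) h9 h7).trans (add_zero 0)
  ext u
  have h3 := mfderiv_comp (I' := 𝓘(ℝ, W).prod 𝓘(ℝ, F)) (ι x)
    (by rw [hr0]; exact hqs.mdifferentiableAt (by simp))
    (hrs.mdifferentiableAt (by simp))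
  rw [hqr.mfderiv_eq, mfderiv_id] at h3
  have h4 : ∀ z : S × F, z = (x, 0) → ∀ w : W × F,
      α ((mfderiv (𝓘(ℝ, W).prod 𝓘(ℝ, F)) 𝓘(ℝ, V) q z : W × F →L[ℝ] V) w) = 0 := by
    rintro z rfl w
    exact hpart w
  have h5 := congrArg (fun L : V →L[ℝ] V => (α : V →L[ℝ] ℝ) (L u)) h3
  exact h5.trans (h4 _ hr0 _)

end ExponentialMap

end Jets

/-! ### The infinitesimal Poisson algebra as a quotient of an algebra of functions on `M` -/

section AffineAlgebra

variable {V : Type*} [NormedAddCommGroup V] [NormedSpace ℝ V]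
  {M : Type*} [TopologicalSpace M] [ChartedSpace V M]
  {W : Type*} [NormedAddCommGroup W] [NormedSpace ℝ W]
  {S : Type*} [TopologicalSpace S] [ChartedSpace W S]
  {F : Type*} [NormedAddCommGroup F] [NormedSpace ℝ F]
  {E : S → Type*} [∀ x, AddCommGroup (E x)] [∀ x, Module ℝ (E x)]
  [TopologicalSpace (Bundle.TotalSpace F E)] [∀ x, TopologicalSpace (E x)]
  [FiberBundle F E] [VectorBundle ℝ F E]
  {ι : S → M}

theorem affineFunctions_ext {φ χ : affineFunctions W F E}
    (h : ∀ (x : S) (v : E x), φ.1 ⟨x, v⟩ = χ.1 ⟨x, v⟩) : φ = χ :=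
  Subtype.ext (DFunLike.ext _ _ fun w => h w.proj w.snd)

theorem affineFunctions_apply_smul (φ : affineFunctions W F E) (x : S) (t : ℝ) (v : E x) :
    φ.1 ⟨x, t • v⟩ = φ.1 ⟨x, 0⟩ + t * (φ.1 ⟨x, v⟩ - φ.1 ⟨x, 0⟩) := by
  obtain ⟨c, l, h⟩ := φ.2 x
  simp only [h, map_smul, map_zero, smul_eq_mul]
  ring

/-- The restriction of a fiberwise affine function to a fiber, minus its constant term. -/
def linearPart (φ : affineFunctions W F E) (x : S) : E x →ₗ[ℝ] ℝ where
  toFun v := φ.1 ⟨x, v⟩ - φ.1 ⟨x, 0⟩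
  map_add' u v := by
    obtain ⟨c, l, h⟩ := φ.2 x
    simp only [h, map_add, map_zero]
    ring
  map_smul' t v := by
    obtain ⟨c, l, h⟩ := φ.2 x
    simp only [h, map_smul, map_zero, smul_eq_mul, RingHom.id_apply]
    ring

theorem linearPart_apply (φ : affineFunctions W F E) (x : S) (v : E x) :
    linearPart φ x v = φ.1 ⟨x, v⟩ - φ.1 ⟨x, 0⟩ := rfl

theorem linearPart_add (φ χ : affineFunctions W F E) (x : S) :
    linearPart (φ + χ) x = linearPart φ x + linearPart χ x := by
  ext v
  change (φ.1 ⟨x, v⟩ + χ.1 ⟨x, v⟩) - (φ.1 ⟨x, 0⟩ + χ.1 ⟨x, 0⟩)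
    = (φ.1 ⟨x, v⟩ - φ.1 ⟨x, 0⟩) + (χ.1 ⟨x, v⟩ - χ.1 ⟨x, 0⟩)
  ring

theorem linearPart_smul (r : ℝ) (φ : affineFunctions W F E) (x : S) :
    linearPart (r • φ) x = r • linearPart φ x := by
  ext v
  change r * φ.1 ⟨x, v⟩ - r * φ.1 ⟨x, 0⟩ = r * (φ.1 ⟨x, v⟩ - φ.1 ⟨x, 0⟩)
  ring

theorem affineFunctions_ext' {φ χ : affineFunctions W F E} (h0 : ∀ x : S, φ.1 ⟨x, 0⟩ = χ.1 ⟨x, 0⟩)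
    (h : ∀ x : S, linearPart φ x = linearPart χ x) : φ = χ :=
  affineFunctions_ext fun x v => by
    have h1 := congrArg (fun l => l v) (h x)
    simp only [linearPart_apply, h0] at h1
    linarith

namespace ExponentialMap

theorem base_mem_target (e : ExponentialMap V W ι F E) (x : S) : ι x ∈ e.toHomeo.target := by
  rw [← e.map_zero]; exact e.toHomeo.map_source (e.zero_mem x)

theorem symm_base (e : ExponentialMap V W ι F E) (x : S) :
    e.toHomeo.symm (ι x) = (⟨x, 0⟩ : Bundle.TotalSpace F E) := by
  rw [← e.map_zero, e.toHomeo.left_inv (e.zero_mem x)]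

theorem mdifferentiableAt (e : ExponentialMap V W ι F E) {f : M → ℝ}
    (hf : ContMDiffOn 𝓘(ℝ, V) 𝓘(ℝ, ℝ) ∞ f e.toHomeo.target) (x : S) :
    MDifferentiableAt 𝓘(ℝ, V) 𝓘(ℝ, ℝ) f (ι x) :=
  (hf.contMDiffAt (e.toHomeo.open_target.mem_nhds (e.base_mem_target x))).mdifferentiableAt
    (by simp)

/-- The function on a neighborhood of `S` in `M` that corresponds to a fiberwise affine function. -/
def pushforward (e : ExponentialMap V W ι F E) (φ : affineFunctions W F E) : M → ℝ :=
  φ.1 ∘ e.toHomeo.symm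

theorem contMDiffOn_pushforward (e : ExponentialMap V W ι F E) (φ : affineFunctions W F E) :
    ContMDiffOn 𝓘(ℝ, V) 𝓘(ℝ, ℝ) ∞ (e.pushforward φ) e.toHomeo.target :=
  φ.1.contMDiff.comp_contMDiffOn e.smooth_symm

theorem pushforward_base (e : ExponentialMap V W ι F E) (φ : affineFunctions W F E) (x : S) :
    e.pushforward φ (ι x) = φ.1 ⟨x, 0⟩ := by
  simp only [pushforward, Function.comp_apply, e.symm_base]

theorem differential_pushforward_normalMap (e : ExponentialMap V W ι F E)
    (φ : affineFunctions W F E) (x : S) (v : E x) :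
    differential V (e.pushforward φ) (ι x) (e.normalMap x v) = linearPart φ x v := by
  have h := e.hasDerivAt_comp_fiberScale x v (e.mdifferentiableAt (e.contMDiffOn_pushforward φ) x)
  have hcont : Continuous fun t : ℝ => fiberScale t (⟨x, v⟩ : Bundle.TotalSpace F E) :=
    (contMDiff_fiberScale (W := W) (F := F) (E := E)).continuous.comp
      (by fun_prop : Continuous fun t : ℝ => (t, (⟨x, v⟩ : Bundle.TotalSpace F E)))
  -- The ray lies in the domain of `e` only for small `t`, which is enough for a derivative at `0`.
  have hmem : ∀ᶠ t : ℝ in 𝓝 0, fiberScale t (⟨x, v⟩ : Bundle.TotalSpace F E) ∈ e.toHomeo.source := by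
    refine hcont.continuousAt.preimage_mem_nhds (e.toHomeo.open_source.mem_nhds ?_)
    simpa [fiberScale] using e.zero_mem x
  refine h.unique ?_
  have h1 : HasDerivAt (fun t : ℝ => φ.1 ⟨x, 0⟩ + t * (φ.1 ⟨x, v⟩ - φ.1 ⟨x, 0⟩))
      (linearPart φ x v) 0 := by
    simpa [linearPart_apply] using
      ((hasDerivAt_id (0 : ℝ)).mul_const (φ.1 ⟨x, v⟩ - φ.1 ⟨x, 0⟩)).const_add (φ.1 ⟨x, 0⟩)
  refine h1.congr_of_eventuallyEq ?_
  filter_upwards [hmem] with t ht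
  simp only [pushforward, Function.comp_apply, e.toHomeo.left_inv ht]
  exact affineFunctions_apply_smul φ x t v

theorem differential_comp_base (e : ExponentialMap V W ι F E) {f : M → ℝ}
    (hf : ContMDiffOn 𝓘(ℝ, V) 𝓘(ℝ, ℝ) ∞ f e.toHomeo.target) (x : S) :
    (differential V f (ι x)).comp (mfderiv 𝓘(ℝ, W) 𝓘(ℝ, V) ι x)
      = differential W (fun x => f (ι x)) x :=
  (mfderiv_comp x (e.mdifferentiableAt hf x)
    (e.contMDiff_base.mdifferentiableAt (by simp))).symm

variable [IsManifold 𝓘(ℝ, W) ∞ S] [ContMDiffVectorBundle ∞ F E 𝓘(ℝ, W)]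

/-- The fiberwise affine part of `f ∘ e`. -/
def affineJet (e : ExponentialMap V W ι F E) (f : M → ℝ)
    (hf : ContMDiffOn 𝓘(ℝ, V) 𝓘(ℝ, ℝ) ∞ f e.toHomeo.target) : affineFunctions W F E :=
  toAffine (f ∘ e.toHomeo) fun x =>
    ((hf.comp e.smooth e.toHomeo.mapsTo).contMDiffAt
      (e.toHomeo.open_source.mem_nhds (e.zero_mem x)))

variable (e : ExponentialMap V W ι F E) {f g : M → ℝ}
  (hf : ContMDiffOn 𝓘(ℝ, V) 𝓘(ℝ, ℝ) ∞ f e.toHomeo.target)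
  (hg : ContMDiffOn 𝓘(ℝ, V) 𝓘(ℝ, ℝ) ∞ g e.toHomeo.target)

theorem affineJet_apply (x : S) (v : E x) :
    (e.affineJet f hf).1 ⟨x, v⟩ = f (ι x) + differential V f (ι x) (e.normalMap x v) := by
  change f (e.toHomeo ⟨x, 0⟩)
    + deriv (fun t : ℝ => f (e.toHomeo (fiberScale t (⟨x, v⟩ : Bundle.TotalSpace F E)))) 0 = _
  rw [e.map_zero, (e.hasDerivAt_comp_fiberScale x v (e.mdifferentiableAt hf x)).deriv]

theorem affineJet_zero (x : S) : (e.affineJet f hf).1 ⟨x, 0⟩ = f (ι x) := by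
  rw [affineJet_apply, _root_.map_zero]
  exact (congrArg (f (ι x) + ·) (_root_.map_zero (differential V f (ι x)))).trans (add_zero _)

theorem linearPart_affineJet (x : S) (v : E x) :
    linearPart (e.affineJet f hf) x v = differential V f (ι x) (e.normalMap x v) := by
  rw [linearPart_apply, affineJet_zero, affineJet_apply, add_sub_cancel_left]

/-- Every element of `𝒫` is thus the jet of a function near `S`, and identities in `𝒫` can be
checked on `M`. -/
theorem affineJet_pushforward (φ : affineFunctions W F E) :
    e.affineJet (e.pushforward φ) (e.contMDiffOn_pushforward φ) = φ :=
  affineFunctions_ext' (fun x => by rw [affineJet_zero, pushforward_base]) fun x => by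
    ext v
    rw [linearPart_affineJet, differential_pushforward_normalMap]

variable {e hf hg} in
theorem affineJet_eq (h0 : ∀ x, f (ι x) = g (ι x))
    (h1 : ∀ x, differential V f (ι x) = differential V g (ι x)) :
    e.affineJet f hf = e.affineJet g hg :=
  affineFunctions_ext fun x v => by rw [affineJet_apply, affineJet_apply, h0, h1]

variable {e hf hg} in
theorem eq_of_affineJet_eq (h : e.affineJet f hf = e.affineJet g hg) (x : S) :
    f (ι x) = g (ι x) := by
  rw [← e.affineJet_zero hf, h, e.affineJet_zero hg]

variable {e hf hg} in
-- The values along `S` determine the differential on `TS`, the linear parts determine it on the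
-- fiber directions, and these span. With `affineJet_eq` this identifies the kernel of the jet map
-- with the functions vanishing to second order.
theorem differential_eq_of_affineJet_eq (h : e.affineJet f hf = e.affineJet g hg) (x : S) :
    differential V f (ι x) = differential V g (ι x) := by
  refine sub_eq_zero.1 (e.covector_eq_zero (fun w => ?_) fun v => ?_)
  · have h1 : (fun x => f (ι x)) = fun x => g (ι x) := funext fun x => eq_of_affineJet_eq h x
    have h2 := (e.differential_comp_base hf x).trans
      ((congrArg (fun k => differential W k x) h1).trans (e.differential_comp_base hg x).symm)
    exact sub_eq_zero.2 (congrArg (fun L => L w) h2)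
  · have h1 := e.linearPart_affineJet hf x v
    rw [h, e.linearPart_affineJet hg] at h1
    exact sub_eq_zero.2 h1.symm

end ExponentialMap

variable [FiniteDimensional ℝ V] [IsManifold 𝓘(ℝ, V) ∞ M] [T2Space M] [IsManifold 𝓘(ℝ, W) ∞ S]
  [ContMDiffVectorBundle ∞ F E 𝓘(ℝ, W)]
  {ψ : PoissonStructure W S} {π : PoissonStructure V M}

theorem affineBracket_eq_affineJet (e : ExponentialMap V W ι F E) (φ χ : affineFunctions W F E) :
    affineBracket π e φ χ = e.affineJet (π.bracket (e.pushforward φ) (e.pushforward χ))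
      (π.contMDiffOn_bracket e.toHomeo.open_target (e.contMDiffOn_pushforward φ)
        (e.contMDiffOn_pushforward χ)) :=
  rfl

theorem IsPoissonSubmanifold.differential_bracket_congr (hS : IsPoissonSubmanifold ψ π ι)
    (e : ExponentialMap V W ι F E) {f g g' : M → ℝ}
    (hf : ContMDiffOn 𝓘(ℝ, V) 𝓘(ℝ, ℝ) ∞ f e.toHomeo.target)
    (hg : ContMDiffOn 𝓘(ℝ, V) 𝓘(ℝ, ℝ) ∞ g e.toHomeo.target)
    (hg' : ContMDiffOn 𝓘(ℝ, V) 𝓘(ℝ, ℝ) ∞ g' e.toHomeo.target)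
    (h1 : ∀ x, differential V g (ι x) = differential V g' (ι x)) (x : S) :
    differential V (π.bracket f g) (ι x) = differential V (π.bracket f g') (ι x) := by
  have hO := e.toHomeo.open_target
  have hm := e.base_mem_target x
  have hsub : ∀ q ∈ e.toHomeo.target, differential V (fun q => g q - g' q) q
      = differential V g q - differential V g' q := fun q hq =>
    differential_sub ((hg.contMDiffAt (hO.mem_nhds hq)).mdifferentiableAt (by simp))
      ((hg'.contMDiffAt (hO.mem_nhds hq)).mdifferentiableAt (by simp))
  have h0 := hS.differential_bracket_eq_zero e.contMDiff_base hO hf (hg.sub hg') hm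
    (fun x => by rw [hsub _ (e.base_mem_target x), h1, sub_self])
  have h2 : π.bracket f (fun q => g q - g' q)
      =ᶠ[𝓝 (ι x)] fun q => π.bracket f g q - π.bracket f g' q := by
    filter_upwards [hO.mem_nhds hm] with q hq
    simp only [PoissonStructure.bracket]
    rw [hsub q hq, map_sub]
  have h3 := differential_sub (e.mdifferentiableAt (π.contMDiffOn_bracket hO hf hg) x)
    (e.mdifferentiableAt (π.contMDiffOn_bracket hO hf hg') x)
  exact sub_eq_zero.1 (h3.symm.trans (h2.symm.mfderiv_eq.trans h0))

/-- The bracket of `𝒫` is the quotient bracket. A function and the pushforward of its jet have the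
same first order data along `S`, and the two arguments are exchanged one at a time, with
skew-symmetry for the first. -/
theorem IsPoissonSubmanifold.affineBracket_affineJet (hS : IsPoissonSubmanifold ψ π ι)
    (e : ExponentialMap V W ι F E) {f g : M → ℝ}
    (hf : ContMDiffOn 𝓘(ℝ, V) 𝓘(ℝ, ℝ) ∞ f e.toHomeo.target)
    (hg : ContMDiffOn 𝓘(ℝ, V) 𝓘(ℝ, ℝ) ∞ g e.toHomeo.target) :
    affineBracket π e (e.affineJet f hf) (e.affineJet g hg)
      = e.affineJet (π.bracket f g) (π.contMDiffOn_bracket e.toHomeo.open_target hf hg) := by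
  rw [affineBracket_eq_affineJet]
  have hf1 := ExponentialMap.differential_eq_of_affineJet_eq
    (e.affineJet_pushforward (e.affineJet f hf))
  have hg1 := ExponentialMap.differential_eq_of_affineJet_eq
    (e.affineJet_pushforward (e.affineJet g hg))
  have hskew : ∀ (u w : M → ℝ) (p : M), differential V (π.bracket u w) p
      = -differential V (π.bracket w u) p := fun u w p => by
    have h : π.bracket u w = -π.bracket w u := funext (π.bracket_skew u w)
    rw [h]
    exact mfderiv_neg
  refine ExponentialMap.affineJet_eq (fun x => ?_) fun x => ?_
  · simp only [PoissonStructure.bracket]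
    rw [hf1, hg1]
  · rw [hS.differential_bracket_congr e (e.contMDiffOn_pushforward _) (e.contMDiffOn_pushforward _)
      hg hg1, hskew, hS.differential_bracket_congr e hg (e.contMDiffOn_pushforward _) hf hf1]
    exact (hskew f g (ι x)).symm

theorem ExponentialMap.affineJet_congr (e : ExponentialMap V W ι F E) {f g : M → ℝ}
    {hf : ContMDiffOn 𝓘(ℝ, V) 𝓘(ℝ, ℝ) ∞ f e.toHomeo.target}
    {hg : ContMDiffOn 𝓘(ℝ, V) 𝓘(ℝ, ℝ) ∞ g e.toHomeo.target}
    (h : EqOn f g e.toHomeo.target) : e.affineJet f hf = e.affineJet g hg :=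
  ExponentialMap.affineJet_eq (fun x => h (e.base_mem_target x)) fun x =>
    (h.eventuallyEq_of_mem (e.toHomeo.open_target.mem_nhds (e.base_mem_target x))).mfderiv_eq

theorem ExponentialMap.affineJet_add (e : ExponentialMap V W ι F E) {f g : M → ℝ}
    (hf : ContMDiffOn 𝓘(ℝ, V) 𝓘(ℝ, ℝ) ∞ f e.toHomeo.target)
    (hg : ContMDiffOn 𝓘(ℝ, V) 𝓘(ℝ, ℝ) ∞ g e.toHomeo.target) :
    e.affineJet (fun q => f q + g q) (hf.add hg) = e.affineJet f hf + e.affineJet g hg :=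
  affineFunctions_ext fun x v => by
    refine Eq.trans ?_ (congrArg₂ (· + ·) (e.affineJet_apply hf x v).symm
      (e.affineJet_apply hg x v).symm)
    rw [e.affineJet_apply, differential_add (e.mdifferentiableAt hf x) (e.mdifferentiableAt hg x)]
    change (f (ι x) + g (ι x)) + (differential V f (ι x) (e.normalMap x v)
      + differential V g (ι x) (e.normalMap x v)) = _
    ring

theorem ExponentialMap.affineJet_const_mul (e : ExponentialMap V W ι F E) {f : M → ℝ} (r : ℝ)
    (hf : ContMDiffOn 𝓘(ℝ, V) 𝓘(ℝ, ℝ) ∞ f e.toHomeo.target) :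
    e.affineJet (fun q => r * f q) (contMDiffOn_const.mul hf) = r • e.affineJet f hf :=
  affineFunctions_ext fun x v => by
    refine Eq.trans ?_ (congrArg (r * ·) (e.affineJet_apply hf x v).symm)
    rw [e.affineJet_apply, differential_const_mul r (e.mdifferentiableAt hf x)]
    change r * f (ι x) + r * (differential V f (ι x) (e.normalMap x v)) = _
    ring

theorem ExponentialMap.affineJet_mul (e : ExponentialMap V W ι F E) {f g : M → ℝ}
    (hf : ContMDiffOn 𝓘(ℝ, V) 𝓘(ℝ, ℝ) ∞ f e.toHomeo.target)
    (hg : ContMDiffOn 𝓘(ℝ, V) 𝓘(ℝ, ℝ) ∞ g e.toHomeo.target) :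
    e.affineJet (fun q => f q * g q) (hf.mul hg)
      = affineMul (e.affineJet f hf) (e.affineJet g hg) :=
  affineFunctions_ext fun x v => by
    rw [affineMul_apply, ← linearPart_apply, ← linearPart_apply]
    simp only [e.linearPart_affineJet, e.affineJet_zero]
    rw [e.affineJet_apply, differential_mul (e.mdifferentiableAt hf x) (e.mdifferentiableAt hg x)]
    rfl

theorem affineBracket_skew (e : ExponentialMap V W ι F E) (φ χ : affineFunctions W F E) :
    affineBracket π e φ χ = -affineBracket π e χ φ := by
  rw [affineBracket_eq_affineJet, affineBracket_eq_affineJet, ← neg_one_smul ℝ,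
    ← e.affineJet_const_mul]
  refine e.affineJet_congr fun q _ => ?_
  rw [π.bracket_skew]
  ring

theorem affineBracket_add_right (e : ExponentialMap V W ι F E) (φ χ θ : affineFunctions W F E) :
    affineBracket π e φ (χ + θ) = affineBracket π e φ χ + affineBracket π e φ θ := by
  rw [affineBracket_eq_affineJet, affineBracket_eq_affineJet, affineBracket_eq_affineJet,
    ← e.affineJet_add]
  refine e.affineJet_congr fun q hq => ?_
  have hd : ∀ φ : affineFunctions W F E,
      MDifferentiableAt 𝓘(ℝ, V) 𝓘(ℝ, ℝ) (e.pushforward φ) q := fun φ =>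
    ((e.contMDiffOn_pushforward φ).contMDiffAt (e.toHomeo.open_target.mem_nhds hq)).mdifferentiableAt
      (by simp)
  exact (congrArg (π.bivector q _) (differential_add (hd χ) (hd θ))).trans (map_add _ _ _)

theorem affineBracket_smul_right (e : ExponentialMap V W ι F E) (r : ℝ)
    (φ χ : affineFunctions W F E) :
    affineBracket π e φ (r • χ) = r • affineBracket π e φ χ := by
  rw [affineBracket_eq_affineJet, affineBracket_eq_affineJet, ← e.affineJet_const_mul]
  refine e.affineJet_congr fun q hq => ?_
  have hd : ∀ φ : affineFunctions W F E,
      MDifferentiableAt 𝓘(ℝ, V) 𝓘(ℝ, ℝ) (e.pushforward φ) q := fun φ =>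
    ((e.contMDiffOn_pushforward φ).contMDiffAt (e.toHomeo.open_target.mem_nhds hq)).mdifferentiableAt
      (by simp)
  exact (congrArg (π.bivector q _) (differential_const_mul r (hd χ))).trans (map_smul _ _ _)

/-- The Hamiltonian derivation `{φ, ·}` as a linear map. -/
def affineHamiltonian (π : PoissonStructure V M) (e : ExponentialMap V W ι F E)
    (φ : affineFunctions W F E) : affineFunctions W F E →ₗ[ℝ] affineFunctions W F E where
  toFun := affineBracket π e φ
  map_add' := affineBracket_add_right e φ
  map_smul' r := affineBracket_smul_right e r φ

/-- The Jacobi identity near `S` descends to jets; this form says that `{φ, ·}` is a derivation of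
the bracket. -/
theorem IsPoissonSubmanifold.affineBracket_jacobi (hS : IsPoissonSubmanifold ψ π ι)
    (e : ExponentialMap V W ι F E) (φ χ θ : affineFunctions W F E) :
    affineBracket π e φ (affineBracket π e χ θ)
      = affineBracket π e (affineBracket π e φ χ) θ
        + affineBracket π e χ (affineBracket π e φ θ) := by
  have key : ∀ φ χ θ : affineFunctions W F E, affineBracket π e φ (affineBracket π e χ θ)
      = e.affineJet (π.bracket (e.pushforward φ) (π.bracket (e.pushforward χ) (e.pushforward θ)))
        (π.contMDiffOn_bracket e.toHomeo.open_target (e.contMDiffOn_pushforward φ)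
          (π.contMDiffOn_bracket e.toHomeo.open_target (e.contMDiffOn_pushforward χ)
            (e.contMDiffOn_pushforward θ))) := fun φ χ θ => by
    conv_lhs => rw [← e.affineJet_pushforward φ, affineBracket_eq_affineJet e χ θ]
    rw [hS.affineBracket_affineJet]
  rw [affineBracket_skew e (affineBracket π e φ χ) θ, eq_neg_add_iff_add_eq,
    affineBracket_skew e φ θ, ← neg_one_smul ℝ, affineBracket_smul_right, key, key, key,
    ← e.affineJet_add, ← e.affineJet_const_mul]
  refine e.affineJet_congr fun q hq => ?_
  have h := π.jacobi_of_contMDiffOn e.toHomeo.open_target (e.contMDiffOn_pushforward φ)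
    (e.contMDiffOn_pushforward χ) (e.contMDiffOn_pushforward θ) hq
  linarith

theorem IsPoissonSubmanifold.affineBracket_affineMul (hS : IsPoissonSubmanifold ψ π ι)
    (e : ExponentialMap V W ι F E) (φ χ θ : affineFunctions W F E) :
    affineBracket π e φ (affineMul χ θ)
      = affineMul (affineBracket π e φ χ) θ + affineMul χ (affineBracket π e φ θ) := by
  conv_lhs => rw [← e.affineJet_pushforward φ, ← e.affineJet_pushforward χ,
    ← e.affineJet_pushforward θ, ← e.affineJet_mul, hS.affineBracket_affineJet]
  conv_rhs =>
    rw [affineBracket_eq_affineJet e φ χ, affineBracket_eq_affineJet e φ θ]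
    enter [1]
    rw [← e.affineJet_pushforward θ, ← e.affineJet_mul]
  conv_rhs =>
    enter [2]
    rw [← e.affineJet_pushforward χ, ← e.affineJet_mul]
  rw [← e.affineJet_add]
  refine e.affineJet_congr fun q hq => ?_
  have hd : ∀ φ : affineFunctions W F E,
      MDifferentiableAt 𝓘(ℝ, V) 𝓘(ℝ, ℝ) (e.pushforward φ) q := fun φ =>
    ((e.contMDiffOn_pushforward φ).contMDiffAt (e.toHomeo.open_target.mem_nhds hq)).mdifferentiableAt
      (by simp)
  simp only [PoissonStructure.bracket]
  rw [differential_mul (hd χ) (hd θ), map_add, map_smul, map_smul, smul_eq_mul, smul_eq_mul]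
  ring

theorem IsPoissonSubmanifold.isPoissonDerivation_affineHamiltonian
    (hS : IsPoissonSubmanifold ψ π ι) (e : ExponentialMap V W ι F E) (φ : affineFunctions W F E) :
    IsPoissonDerivation π e (affineHamiltonian π e φ) :=
  ⟨hS.affineBracket_affineMul e φ, hS.affineBracket_jacobi e φ⟩

theorem affineBracket_add_left (e : ExponentialMap V W ι F E) (φ χ θ : affineFunctions W F E) :
    affineBracket π e (φ + χ) θ = affineBracket π e φ θ + affineBracket π e χ θ := by
  rw [affineBracket_skew, affineBracket_add_right, affineBracket_skew e φ, affineBracket_skew e χ,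
    neg_add]

theorem affineMul_add_left (φ χ θ : affineFunctions W F E) :
    affineMul (φ + χ) θ = affineMul φ θ + affineMul χ θ :=
  affineFunctions_ext fun x v => by
    refine Eq.trans ?_ (congrArg₂ (· + ·) (affineMul_apply φ θ x v).symm
      (affineMul_apply χ θ x v).symm)
    rw [affineMul_apply]
    change (φ.1 _ + χ.1 _) * _ + ((φ.1 _ + χ.1 _) * _ + _ * ((φ.1 _ + χ.1 _) - (φ.1 _ + χ.1 _))) = _
    ring

theorem affineMul_comm (φ χ : affineFunctions W F E) : affineMul φ χ = affineMul χ φ :=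
  affineFunctions_ext fun x v => by
    rw [affineMul_apply, affineMul_apply]
    ring

theorem IsPoissonDerivation.sub {e : ExponentialMap V W ι F E}
    {X Y : affineFunctions W F E →ₗ[ℝ] affineFunctions W F E} (hX : IsPoissonDerivation π e X)
    (hY : IsPoissonDerivation π e Y) : IsPoissonDerivation π e (X - Y) where
  leibniz φ χ := by
    have h1 : ∀ a b c : affineFunctions W F E, affineMul (a - b) c
        = affineMul a c - affineMul b c := fun a b c => by
      rw [eq_sub_iff_add_eq, ← affineMul_add_left, sub_add_cancel]
    have h2 : ∀ a b c : affineFunctions W F E, affineMul c (a - b)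
        = affineMul c a - affineMul c b := fun a b c => by
      rw [affineMul_comm, h1, affineMul_comm a, affineMul_comm b]
    simp only [LinearMap.sub_apply, h1, h2, hX.leibniz, hY.leibniz]
    abel
  bracket φ χ := by
    have h1 : ∀ a b c : affineFunctions W F E, affineBracket π e (a - b) c
        = affineBracket π e a c - affineBracket π e b c := fun a b c => by
      rw [eq_sub_iff_add_eq, ← affineBracket_add_left, sub_add_cancel]
    have h2 : ∀ a b c : affineFunctions W F E, affineBracket π e c (a - b)
        = affineBracket π e c a - affineBracket π e c b := fun a b c => by
      rw [eq_sub_iff_add_eq, ← affineBracket_add_right, sub_add_cancel]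
    simp only [LinearMap.sub_apply, h1, h2, hX.bracket, hY.bracket]
    abel

end AffineAlgebra

/-! ### Functions on the base and fiberwise linear functions -/

section BaseAndLinear

variable {V : Type*} [NormedAddCommGroup V] [NormedSpace ℝ V]
  {M : Type*} [TopologicalSpace M] [ChartedSpace V M]
  {W : Type*} [NormedAddCommGroup W] [NormedSpace ℝ W]
  {S : Type*} [TopologicalSpace S] [ChartedSpace W S]
  {F : Type*} [NormedAddCommGroup F] [NormedSpace ℝ F]
  {E : S → Type*} [∀ x, AddCommGroup (E x)] [∀ x, Module ℝ (E x)]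
  [TopologicalSpace (Bundle.TotalSpace F E)] [∀ x, TopologicalSpace (E x)]
  [FiberBundle F E] [VectorBundle ℝ F E]
  {ι : S → M}

/-- A fiberwise affine function is fiberwise linear if it vanishes on the zero section. -/
def IsFiberwiseLinear (φ : affineFunctions W F E) : Prop :=
  ∀ x : S, φ.1 ⟨x, 0⟩ = 0

theorem IsFiberwiseLinear.linearPart_apply {φ : affineFunctions W F E} (h : IsFiberwiseLinear φ)
    (x : S) (v : E x) : linearPart φ x v = φ.1 ⟨x, v⟩ := by
  rw [PoissonGeometry.linearPart_apply, h x, sub_zero]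

theorem IsFiberwiseLinear.ext {φ χ : affineFunctions W F E} (hφ : IsFiberwiseLinear φ)
    (hχ : IsFiberwiseLinear χ) (h : ∀ x : S, linearPart φ x = linearPart χ x) : φ = χ :=
  affineFunctions_ext' (fun x => (hφ x).trans (hχ x).symm) h

theorem IsFiberwiseLinear.add {φ χ : affineFunctions W F E} (hφ : IsFiberwiseLinear φ)
    (hχ : IsFiberwiseLinear χ) : IsFiberwiseLinear (φ + χ) := fun x => by
  change φ.1 ⟨x, 0⟩ + χ.1 ⟨x, 0⟩ = 0
  rw [hφ, hχ, add_zero]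

theorem IsFiberwiseLinear.smul (r : ℝ) {φ : affineFunctions W F E} (hφ : IsFiberwiseLinear φ) :
    IsFiberwiseLinear (r • φ) := fun x => by
  change r * φ.1 ⟨x, 0⟩ = 0
  rw [hφ, mul_zero]

theorem IsFiberwiseLinear.sub {φ χ : affineFunctions W F E} (hφ : IsFiberwiseLinear φ)
    (hχ : IsFiberwiseLinear χ) : IsFiberwiseLinear (φ - χ) := fun x => by
  change φ.1 ⟨x, 0⟩ - χ.1 ⟨x, 0⟩ = 0
  rw [hφ, hχ, sub_zero]

/-- A function on `S`, as a function on `E` that is constant on the fibers. -/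
def ofBase (f : C^∞⟮𝓘(ℝ, W), S; 𝓘(ℝ, ℝ), ℝ⟯) : affineFunctions W F E :=
  ⟨⟨fun w => f w.proj, f.contMDiff.comp (Bundle.contMDiff_proj E)⟩,
    fun x => ⟨f x, 0, fun v => by simp⟩⟩

theorem ofBase_apply (f : C^∞⟮𝓘(ℝ, W), S; 𝓘(ℝ, ℝ), ℝ⟯) (w : Bundle.TotalSpace F E) :
    (ofBase f : affineFunctions W F E).1 w = f w.proj := rfl

/-- The product of a function on `S` which is supported in `U` with a function which is smooth
over `U`. -/
theorem contMDiff_bump_mul {H N : Type*} [NormedAddCommGroup H] [NormedSpace ℝ H]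
    {K : Type*} [TopologicalSpace K] {I : ModelWithCorners ℝ H K}
    [TopologicalSpace N] [ChartedSpace K N] {k : N → S} (hk : ContMDiff I 𝓘(ℝ, W) ∞ k)
    (b : C^∞⟮𝓘(ℝ, W), S; 𝓘(ℝ, ℝ), ℝ⟯) {U : Set S} (hb : tsupport b ⊆ U) {g : N → ℝ}
    (hg : ∀ w, k w ∈ U → ContMDiffAt I 𝓘(ℝ, ℝ) ∞ g w) :
    ContMDiff I 𝓘(ℝ, ℝ) ∞ (fun w => b (k w) * g w) := by
  intro w
  by_cases hw : k w ∈ U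
  · exact ((b.contMDiff.comp hk).contMDiffAt).mul (hg w hw)
  · have h0 : (fun w => b (k w) * g w) =ᶠ[𝓝 w] fun _ => 0 := by
      have h1 : (tsupport b)ᶜ ∈ 𝓝 (k w) :=
        (isClosed_tsupport b).isOpen_compl.mem_nhds fun h => hw (hb h)
      filter_upwards [hk.continuous.continuousAt.preimage_mem_nhds h1] with z hz
      rw [image_eq_zero_of_notMem_tsupport hz, zero_mul]
    exact contMDiffAt_const.congr_of_eventuallyEq h0

variable [ContMDiffVectorBundle ∞ F E 𝓘(ℝ, W)]

/-- The restriction to the base of a fiberwise affine function. -/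
def basePart (φ : affineFunctions W F E) : C^∞⟮𝓘(ℝ, W), S; 𝓘(ℝ, ℝ), ℝ⟯ :=
  ⟨fun x => φ.1 ⟨x, 0⟩, φ.1.contMDiff.comp (Bundle.contMDiff_zeroSection ℝ E)⟩

theorem isFiberwiseLinear_sub_ofBase (φ : affineFunctions W F E) :
    IsFiberwiseLinear (φ - ofBase (basePart φ)) := fun x =>
  sub_self (φ.1 ⟨x, 0⟩)

/-- A linear form on the typical fiber, as a fiberwise linear function on `E`, cut off by a
function which is supported in the domain of a trivialization. -/
def cutoffLinear {x₀ : S} (b : C^∞⟮𝓘(ℝ, W), S; 𝓘(ℝ, ℝ), ℝ⟯)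
    (hb : tsupport b ⊆ (trivializationAt F E x₀).baseSet) (k : F →L[ℝ] ℝ) :
    affineFunctions W F E :=
  ⟨⟨fun w => b w.proj * k (trivializationAt F E x₀ w).2, contMDiff_bump_mul
    (Bundle.contMDiff_proj E) b hb fun w hw =>
      (k.contMDiff (n := ∞)).contMDiffAt.comp w (contMDiffAt_snd.comp w
        ((trivializationAt F E x₀).contMDiffOn.contMDiffAt
          ((trivializationAt F E x₀).open_source.mem_nhds
            ((trivializationAt F E x₀).mem_source.2 hw))))⟩,
    fun x => by
      by_cases hx : x ∈ (trivializationAt F E x₀).baseSet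
      · refine ⟨0, b x • (k.toLinearMap ∘ₗ
          ((trivializationAt F E x₀).continuousLinearMapAt ℝ x).toLinearMap), fun v => ?_⟩
        have h := congrFun ((trivializationAt F E x₀).coe_linearMapAt_of_mem (R := ℝ) hx) v
        change b x * k _ = 0 + b x * k _
        rw [zero_add]
        exact congrArg (fun u => b x * k u) h.symm
      · refine ⟨0, 0, fun v => ?_⟩
        change b x * _ = _
        rw [image_eq_zero_of_notMem_tsupport fun h => hx (hb h)]
        simp⟩

theorem cutoffLinear_apply {x₀ : S} (b : C^∞⟮𝓘(ℝ, W), S; 𝓘(ℝ, ℝ), ℝ⟯)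
    (hb : tsupport b ⊆ (trivializationAt F E x₀).baseSet) (k : F →L[ℝ] ℝ) {x : S}
    (hx : x ∈ (trivializationAt F E x₀).baseSet) (v : E x) :
    (cutoffLinear b hb k).1 ⟨x, v⟩
      = b x * k ((trivializationAt F E x₀).continuousLinearMapAt ℝ x v) := by
  have h := congrFun ((trivializationAt F E x₀).coe_linearMapAt_of_mem (R := ℝ) hx) v
  exact congrArg (fun u => b x * k u) h.symm

theorem isFiberwiseLinear_cutoffLinear {x₀ : S} (b : C^∞⟮𝓘(ℝ, W), S; 𝓘(ℝ, ℝ), ℝ⟯)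
    (hb : tsupport b ⊆ (trivializationAt F E x₀).baseSet) (k : F →L[ℝ] ℝ) :
    IsFiberwiseLinear (cutoffLinear b hb k) := fun x => by
  by_cases hx : x ∈ (trivializationAt F E x₀).baseSet
  · rw [cutoffLinear_apply b hb k hx, map_zero, map_zero, mul_zero]
  · change b x * _ = _
    rw [image_eq_zero_of_notMem_tsupport fun h => hx (hb h), zero_mul]

variable [IsManifold 𝓘(ℝ, W) ∞ S]

theorem affineMul_ofBase (f : C^∞⟮𝓘(ℝ, W), S; 𝓘(ℝ, ℝ), ℝ⟯) (φ : affineFunctions W F E) (x : S)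
    (v : E x) : (affineMul (ofBase f) φ).1 ⟨x, v⟩ = f x * φ.1 ⟨x, v⟩ := by
  rw [affineMul_apply]
  simp only [ofBase_apply]
  ring

theorem ofBase_mul (f g : C^∞⟮𝓘(ℝ, W), S; 𝓘(ℝ, ℝ), ℝ⟯) :
    (ofBase (f * g) : affineFunctions W F E) = affineMul (ofBase f) (ofBase g) :=
  affineFunctions_ext fun x v => by
    rw [affineMul_ofBase]
    rfl

theorem affineMul_zero_section (φ χ : affineFunctions W F E) (x : S) :
    (affineMul φ χ).1 ⟨x, 0⟩ = φ.1 ⟨x, 0⟩ * χ.1 ⟨x, 0⟩ := by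
  rw [affineMul_apply]
  ring

/-- A product of two linear functions is quadratic along the fibers, so its affine part is zero.
This square-zero property is what controls derivations. -/
theorem IsFiberwiseLinear.affineMul {φ χ : affineFunctions W F E} (hφ : IsFiberwiseLinear φ)
    (hχ : IsFiberwiseLinear χ) : PoissonGeometry.affineMul φ χ = 0 :=
  affineFunctions_ext fun x v => by
    rw [affineMul_apply, hφ, hχ]
    simp only [zero_mul, add_zero]
    rfl

variable [FiniteDimensional ℝ W] [T2Space S] [FiniteDimensional ℝ F]

theorem exists_linearPart_eq {x : S} (l : E x →ₗ[ℝ] ℝ) :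
    ∃ η : affineFunctions W F E, IsFiberwiseLinear η ∧ linearPart η x = l := by
  set T := trivializationAt F E x
  have hx : x ∈ T.baseSet := FiberBundle.mem_baseSet_trivializationAt' x
  obtain ⟨b, hb1, hb⟩ := exists_bump (V := W) (T.open_baseSet.mem_nhds hx)
  set k : F →L[ℝ] ℝ := (l ∘ₗ (T.symmL ℝ x).toLinearMap).toContinuousLinearMap
  refine ⟨cutoffLinear b hb k, isFiberwiseLinear_cutoffLinear b hb k, ?_⟩
  ext v
  rw [(isFiberwiseLinear_cutoffLinear b hb k).linearPart_apply, cutoffLinear_apply b hb k hx,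
    hb1.self_of_nhds, one_mul]
  exact congrArg l (T.symmL_continuousLinearMapAt hx v)

/-- A fiberwise linear function which vanishes on `E_x` is, near `x`, a combination of fiberwise
linear functions with coefficients that vanish at `x`. -/
theorem exists_eq_sum_affineMul {x : S} {η : affineFunctions W F E} (hη : IsFiberwiseLinear η)
    (hx0 : linearPart η x = 0) :
    ∃ (b : C^∞⟮𝓘(ℝ, W), S; 𝓘(ℝ, ℝ), ℝ⟯) (n : ℕ) (f : Fin n → C^∞⟮𝓘(ℝ, W), S; 𝓘(ℝ, ℝ), ℝ⟯)
      (l : Fin n → affineFunctions W F E), b x = 1 ∧ (∀ i, f i x = 0) ∧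
      (∀ i, IsFiberwiseLinear (l i)) ∧
      affineMul (ofBase b) η = ∑ i, affineMul (ofBase (f i)) (l i) := by
  set T := trivializationAt F E x
  have hx : x ∈ T.baseSet := FiberBundle.mem_baseSet_trivializationAt' x
  obtain ⟨b, hb1, hb⟩ := exists_bump (V := W) (T.open_baseSet.mem_nhds hx)
  set c := Module.finBasis ℝ F
  have hf : ∀ i, ContMDiff 𝓘(ℝ, W) 𝓘(ℝ, ℝ) ∞
      (fun z : S => b z * η.1 (T.toOpenPartialHomeomorph.symm (z, c i))) := fun i =>
    contMDiff_bump_mul contMDiff_id b hb fun z hz => by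
      refine η.1.contMDiff.contMDiffAt.comp z ?_
      have h1 := (T.contMDiffOn_symm (n := ∞) (IB := 𝓘(ℝ, W))).contMDiffAt (x := (z, c i))
        (T.open_target.mem_nhds (T.mem_target.2 hz))
      exact h1.comp z (contMDiffAt_id.prodMk contMDiffAt_const)
  set f : Fin (Module.finrank ℝ F) → C^∞⟮𝓘(ℝ, W), S; 𝓘(ℝ, ℝ), ℝ⟯ := fun i => ⟨_, hf i⟩ with hf'
  have hfT : ∀ z ∈ T.baseSet, ∀ i, η.1 (T.toOpenPartialHomeomorph.symm (z, c i))
      = linearPart η z (T.symmL ℝ z (c i)) := fun z hz i => by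
    rw [hη.linearPart_apply, ← T.mk_symm hz, T.symmL_apply (R := ℝ) hz]
  -- One factor `b` makes the coefficients of `η` global, the other the linear coordinates of the
  -- trivialization; hence the cutoff `b * b`.
  refine ⟨b * b, _, f,
    fun i => cutoffLinear b hb (c.coord i).toContinuousLinearMap, ?_, fun i => ?_,
    fun i => isFiberwiseLinear_cutoffLinear b hb _, ?_⟩
  · change b x * b x = 1
    rw [hb1.self_of_nhds, one_mul]
  · change b x * η.1 (T.toOpenPartialHomeomorph.symm (x, c i)) = 0
    rw [hfT x hx, hx0, LinearMap.zero_apply, mul_zero]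
  · refine affineFunctions_ext fun z v => ?_
    have hsum : (∑ i, affineMul (ofBase (f i))
          (cutoffLinear b hb (c.coord i).toContinuousLinearMap)).1 ⟨z, v⟩
        = ∑ i, (affineMul (ofBase (f i))
          (cutoffLinear b hb (c.coord i).toContinuousLinearMap)).1 ⟨z, v⟩ := by
      exact map_sum (({ toFun := fun φ => φ.1 ⟨z, v⟩, map_zero' := rfl, map_add' := fun _ _ => rfl } :
        affineFunctions W F E →+ ℝ)) _ _
    rw [hsum, affineMul_ofBase]
    simp only [affineMul_ofBase]
    change b z * b z * _ = ∑ i, (b z * η.1 (T.toOpenPartialHomeomorph.symm (z, c i))) * _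
    by_cases hz : z ∈ T.baseSet
    · have h1 : η.1 ⟨z, v⟩ = ∑ i, c.coord i (T.continuousLinearMapAt ℝ z v)
          * linearPart η z (T.symmL ℝ z (c i)) := by
        have h2 : v = ∑ i, c.coord i (T.continuousLinearMapAt ℝ z v) • T.symmL ℝ z (c i) := by
          conv_lhs => rw [← T.symmL_continuousLinearMapAt (R := ℝ) hz v,
            ← c.sum_repr (T.continuousLinearMapAt ℝ z v), map_sum]
          simp only [map_smul]
          rfl
        rw [← hη.linearPart_apply]
        conv_lhs => rw [h2, map_sum]
        simp only [map_smul, smul_eq_mul]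
      rw [h1, Finset.mul_sum]
      refine Finset.sum_congr rfl fun i _ => ?_
      rw [hfT z hz, cutoffLinear_apply b hb _ hz]
      change _ = _ * (b z * c.coord i _)
      ring
    · rw [image_eq_zero_of_notMem_tsupport fun h => hz (hb h)]
      simp

end BaseAndLinear

/-! ### Derivations of the infinitesimal Poisson algebra -/

section Derivations

variable {V : Type*} [NormedAddCommGroup V] [NormedSpace ℝ V]
  {M : Type*} [TopologicalSpace M] [ChartedSpace V M]
  {W : Type*} [NormedAddCommGroup W] [NormedSpace ℝ W]
  {S : Type*} [TopologicalSpace S] [ChartedSpace W S]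
  {F : Type*} [NormedAddCommGroup F] [NormedSpace ℝ F]
  {E : S → Type*} [∀ x, AddCommGroup (E x)] [∀ x, Module ℝ (E x)]
  [TopologicalSpace (Bundle.TotalSpace F E)] [∀ x, TopologicalSpace (E x)]
  [FiberBundle F E] [VectorBundle ℝ F E]
  {ι : S → M}
  [FiniteDimensional ℝ V] [IsManifold 𝓘(ℝ, V) ∞ M] [T2Space M] [IsManifold 𝓘(ℝ, W) ∞ S]
  [ContMDiffVectorBundle ∞ F E 𝓘(ℝ, W)]
  {ψ : PoissonStructure W S} {π : PoissonStructure V M}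

/-- Restriction to the zero section is a Poisson map from `𝒫` to `C^∞(S)`, because `π` along `S` is
pushed forward from `ψ`. Its kernel consists of the fiberwise linear functions. -/
theorem IsPoissonSubmanifold.affineBracket_zero_section (hS : IsPoissonSubmanifold ψ π ι)
    (e : ExponentialMap V W ι F E) (φ χ : affineFunctions W F E) (x : S) :
    (affineBracket π e φ χ).1 ⟨x, 0⟩ = ψ.bracket (basePart φ) (basePart χ) x := by
  have h : ∀ φ : affineFunctions W F E,
      (differential V (e.pushforward φ) (ι x)).comp (mfderiv 𝓘(ℝ, W) 𝓘(ℝ, V) ι x)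
        = differential W (basePart φ) x := fun φ => by
    rw [e.differential_comp_base (e.contMDiffOn_pushforward φ)]
    simp only [e.pushforward_base]
    rfl
  rw [affineBracket_eq_affineJet, e.affineJet_zero]
  refine (hS.poisson x _ _).trans ?_
  rw [h, h]
  rfl

theorem IsFiberwiseLinear.basePart_eq {φ : affineFunctions W F E} (h : IsFiberwiseLinear φ) :
    ⇑(basePart φ) = fun _ => 0 := funext h

theorem IsPoissonSubmanifold.isFiberwiseLinear_affineBracket (hS : IsPoissonSubmanifold ψ π ι)
    (e : ExponentialMap V W ι F E) (φ : affineFunctions W F E) {χ : affineFunctions W F E}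
    (hχ : IsFiberwiseLinear χ) : IsFiberwiseLinear (affineBracket π e φ χ) := fun x => by
  rw [hS.affineBracket_zero_section, hχ.basePart_eq]
  have h : differential W (fun _ : S => (0 : ℝ)) x = 0 := mfderiv_const
  simp only [PoissonStructure.bracket, h, map_zero]

theorem IsPoissonSubmanifold.isFiberwiseLinear_affineBracket_left
    (hS : IsPoissonSubmanifold ψ π ι) (e : ExponentialMap V W ι F E) {φ : affineFunctions W F E}
    (χ : affineFunctions W F E) (hφ : IsFiberwiseLinear φ) :
    IsFiberwiseLinear (affineBracket π e φ χ) := by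
  rw [affineBracket_skew, ← neg_one_smul ℝ]
  exact (hS.isFiberwiseLinear_affineBracket e χ hφ).smul (-1)

namespace IsPoissonDerivation

variable {e : ExponentialMap V W ι F E}
  {X : affineFunctions W F E →ₗ[ℝ] affineFunctions W F E}
  [FiniteDimensional ℝ W] [T2Space S]

/-- Applying `X` to `η · η = 0` gives `2 (Xη)|_S · η = 0`. So `η` vanishes over the open set where
`(Xη)|_S ≠ 0`; derivations being local, `Xη` vanishes there too, and the set is empty. -/
theorem isFiberwiseLinear (hX : IsPoissonDerivation π e X) {η : affineFunctions W F E}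
    (hη : IsFiberwiseLinear η) : IsFiberwiseLinear (X η) := by
  intro x
  by_contra hne
  have h0 : ∀ (z : S) (v : E z), (X η).1 ⟨z, 0⟩ * η.1 ⟨z, v⟩ = 0 := fun z v => by
    have h1 := hX.leibniz η η
    rw [hη.affineMul hη, map_zero, affineMul_comm η] at h1
    have h2 := congrArg (fun φ : affineFunctions W F E => φ.1 ⟨z, v⟩) h1
    have h3 : (0 : ℝ) = (affineMul (X η) η).1 ⟨z, v⟩ + (affineMul (X η) η).1 ⟨z, v⟩ := h2
    rw [affineMul_apply, hη] at h3
    linarith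
  have hnhds : {z : S | (X η).1 ⟨z, 0⟩ ≠ 0} ∈ 𝓝 x :=
    (basePart (X η)).contMDiff.continuous.continuousAt.eventually_ne hne
  obtain ⟨b, hb1, hb⟩ := exists_bump (V := W) hnhds
  -- The bump function is supported where `η` has been shown to vanish.
  have h1 : affineMul (ofBase b) η = 0 := affineFunctions_ext fun z v => by
    rw [affineMul_ofBase]
    change _ = (0 : ℝ)
    by_cases hz : b z = 0
    · rw [hz, zero_mul]
    · rw [(mul_eq_zero.1 (h0 z v)).resolve_left (hb (subset_tsupport _ hz)), mul_zero]
  have h2 := hX.leibniz (ofBase b) η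
  rw [h1, map_zero] at h2
  have h3 := congrArg (fun φ : affineFunctions W F E => φ.1 ⟨x, 0⟩) h2
  have h4 : (0 : ℝ) = (affineMul (X (ofBase b)) η).1 ⟨x, 0⟩
    + (affineMul (ofBase b) (X η)).1 ⟨x, 0⟩ := h3
  rw [affineMul_zero_section, affineMul_ofBase, hη, hb1.self_of_nhds] at h4
  exact hne (by linarith)

/-- The derivation of `C^∞(S)` induced by a derivation of the infinitesimal Poisson algebra. -/
def baseDerivation (X : affineFunctions W F E →ₗ[ℝ] affineFunctions W F E) :
    C^∞⟮𝓘(ℝ, W), S; 𝓘(ℝ, ℝ), ℝ⟯ →ₗ[ℝ] C^∞⟮𝓘(ℝ, W), S; 𝓘(ℝ, ℝ), ℝ⟯ where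
  toFun f := basePart (X (ofBase f))
  map_add' f g := by
    have h : (ofBase (f + g) : affineFunctions W F E) = ofBase f + ofBase g := rfl
    rw [h, map_add]
    rfl
  map_smul' r f := by
    have h : (ofBase (r • f) : affineFunctions W F E) = r • ofBase f := rfl
    rw [h, map_smul]
    rfl

theorem baseDerivation_apply (X : affineFunctions W F E →ₗ[ℝ] affineFunctions W F E)
    (f : C^∞⟮𝓘(ℝ, W), S; 𝓘(ℝ, ℝ), ℝ⟯) (x : S) :
    baseDerivation X f x = (X (ofBase f)).1 ⟨x, 0⟩ := rfl

/-- Since fiberwise linear functions are preserved, `X` descends to the quotient `C^∞(S)`. -/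
theorem apply_zero_section (hX : IsPoissonDerivation π e X) (φ : affineFunctions W F E) (x : S) :
    (X φ).1 ⟨x, 0⟩ = baseDerivation X (basePart φ) x := by
  have h := hX.isFiberwiseLinear (isFiberwiseLinear_sub_ofBase φ) x
  rw [map_sub] at h
  exact sub_eq_zero.1 h

theorem exists_hamiltonian (hS : IsPoissonSubmanifold ψ π ι) (hψ : ψ.FirstCohomologyTrivial)
    (hX : IsPoissonDerivation π e X) :
    ∃ h : C^∞⟮𝓘(ℝ, W), S; 𝓘(ℝ, ℝ), ℝ⟯, ∀ f x, baseDerivation X f x = ψ.bracket h f x := by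
  obtain ⟨Y, hYs, hY⟩ := exists_vectorField_of_derivation (baseDerivation X) fun f g => by
    ext x
    change _ = f x * baseDerivation X g x + g x * baseDerivation X f x
    rw [baseDerivation_apply, ofBase_mul, hX.leibniz, affineMul_comm]
    change (affineMul (ofBase g) (X (ofBase f))).1 _ + (affineMul (ofBase f) (X (ofBase g))).1 _ = _
    rw [affineMul_ofBase, affineMul_ofBase, baseDerivation_apply, baseDerivation_apply]
    ring
  -- The induced vector field is Poisson: restriction to `S` intertwines the brackets, so the
  -- bracket rule for `X` passes to the base.
  obtain ⟨h, hh⟩ := hψ Y ⟨hYs, fun f g x => by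
    set k : C^∞⟮𝓘(ℝ, W), S; 𝓘(ℝ, ℝ), ℝ⟯ := ⟨ψ.bracket f g, ψ.smooth f g⟩
    have hk : basePart (affineBracket π e (ofBase f) (ofBase g)) = k := by
      ext z
      exact hS.affineBracket_zero_section e _ _ z
    have h1 := hX.apply_zero_section (affineBracket π e (ofBase f) (ofBase g)) x
    rw [hk, hY, hX.bracket] at h1
    refine h1.symm.trans ?_
    refine (congrArg₂ (· + ·) (hS.affineBracket_zero_section e _ _ x)
      (hS.affineBracket_zero_section e _ _ x)).trans ?_
    have h2 : ∀ f : C^∞⟮𝓘(ℝ, W), S; 𝓘(ℝ, ℝ), ℝ⟯,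
        ⇑(basePart (X (ofBase f))) = fun q => differential W f q (Y q) := fun f =>
      funext fun q => hY f q
    rw [h2, h2]
    rfl⟩
  exact ⟨h, fun f x => (hY f x).trans (hh x _)⟩

/-- If `X` takes values in fiberwise linear functions, then `X(f) · η = 0` and `X(f η) = f X(η)`.
Such an operator is tensorial: it acts on each fiber of `E*` separately. -/
theorem linearPart_eq_zero [FiniteDimensional ℝ F] (hX : IsPoissonDerivation π e X)
    (hX0 : ∀ φ, IsFiberwiseLinear (X φ)) {η : affineFunctions W F E} (hη : IsFiberwiseLinear η)
    {x : S} (hx : linearPart η x = 0) : linearPart (X η) x = 0 := by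
  obtain ⟨b, n, f, l, hb, hf, hl, hsum⟩ := exists_eq_sum_affineMul hη hx
  have hmul : ∀ (f : C^∞⟮𝓘(ℝ, W), S; 𝓘(ℝ, ℝ), ℝ⟯) {η : affineFunctions W F E},
      IsFiberwiseLinear η → X (affineMul (ofBase f) η) = affineMul (ofBase f) (X η) :=
    fun f η hη => by rw [hX.leibniz, (hX0 _).affineMul hη, zero_add]
  have h1 := congrArg X hsum
  rw [hmul b hη, map_sum] at h1
  simp only [hmul _ (hl _)] at h1
  ext v
  have h2 := congrArg (fun φ : affineFunctions W F E => φ.1 ⟨x, v⟩) h1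
  have h3 : (∑ i, affineMul (ofBase (f i)) (X (l i))).1 ⟨x, v⟩
      = ∑ i, (affineMul (ofBase (f i)) (X (l i))).1 ⟨x, v⟩ :=
    map_sum (({ toFun := fun φ => φ.1 ⟨x, v⟩, map_zero' := rfl, map_add' := fun _ _ => rfl } :
      affineFunctions W F E →+ ℝ)) _ _
  have h4 := h2.trans h3
  simp only [affineMul_ofBase, hb, hf, one_mul, zero_mul, Finset.sum_const_zero] at h4
  rw [(hX0 η).linearPart_apply, h4]
  rfl

theorem linearPart_congr [FiniteDimensional ℝ F] (hX : IsPoissonDerivation π e X)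
    (hX0 : ∀ φ, IsFiberwiseLinear (X φ)) {η ξ : affineFunctions W F E} (hη : IsFiberwiseLinear η)
    (hξ : IsFiberwiseLinear ξ) {x : S} (h : linearPart η x = linearPart ξ x) :
    linearPart (X η) x = linearPart (X ξ) x := by
  have hsub : ∀ η ξ : affineFunctions W F E,
      linearPart (η - ξ) x = linearPart η x - linearPart ξ x := fun η ξ => by
    rw [eq_sub_iff_add_eq, ← linearPart_add, sub_add_cancel]
  have h1 := hX.linearPart_eq_zero hX0 (hη.sub hξ) (x := x) (by rw [hsub, h, sub_self])
  rw [map_sub, hsub] at h1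
  exact sub_eq_zero.1 h1

end IsPoissonDerivation

end Derivations

/-! ### Frames of the conormal bundle -/

section LieFrames

variable {V : Type*} [NormedAddCommGroup V] [NormedSpace ℝ V]
  {M : Type*} [TopologicalSpace M] [ChartedSpace V M]
  {W : Type*} [NormedAddCommGroup W] [NormedSpace ℝ W]
  {S : Type*} [TopologicalSpace S] [ChartedSpace W S]
  {F : Type*} [NormedAddCommGroup F] [NormedSpace ℝ F]
  {E : S → Type*} [∀ x, AddCommGroup (E x)] [∀ x, Module ℝ (E x)]
  [TopologicalSpace (Bundle.TotalSpace F E)] [∀ x, TopologicalSpace (E x)]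
  [FiberBundle F E] [VectorBundle ℝ F E]
  {ι : S → M}
  [FiniteDimensional ℝ V] [IsManifold 𝓘(ℝ, V) ∞ M] [T2Space M] [IsManifold 𝓘(ℝ, W) ∞ S]
  [ContMDiffVectorBundle ∞ F E 𝓘(ℝ, W)]
  {ψ : PoissonStructure W S} {π : PoissonStructure V M}

/-- Near `x₀`, a smooth section of `T*_S M` is a combination with smooth coefficients of the
differentials of the coordinates at `ι x₀`. -/
theorem exists_coefficients {σ : ∀ x : S, Cotangent V (ι x)} {U : Set S} (hU : IsOpen U)
    (hσ : ContMDiffOn 𝓘(ℝ, W) (𝓘(ℝ, V).prod 𝓘(ℝ, V →L[ℝ] ℝ)) ∞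
      (fun x => (Bundle.TotalSpace.mk' (V →L[ℝ] ℝ) (ι x) (σ x) :
        Bundle.TotalSpace (V →L[ℝ] ℝ)
          (fun p : M => TangentSpace 𝓘(ℝ, V) p →L[ℝ] Bundle.Trivial M ℝ p))) U)
    (hι : Continuous ι) {x₀ : S} (hx₀ : x₀ ∈ U) :
    ∃ (s : S → V →L[ℝ] ℝ) (O : Set S), IsOpen O ∧ x₀ ∈ O ∧ ContMDiffOn 𝓘(ℝ, W) 𝓘(ℝ, V →L[ℝ] ℝ) ∞ s O ∧
      ∀ x ∈ O, σ x = (s x).comp (mfderiv 𝓘(ℝ, V) 𝓘(ℝ, V) (extChartAt 𝓘(ℝ, V) (ι x₀)) (ι x)) := by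
  set T := trivializationAt (V →L[ℝ] ℝ)
    (fun p : M => TangentSpace 𝓘(ℝ, V) p →L[ℝ] Bundle.Trivial M ℝ p) (ι x₀) with hT
  set O := U ∩ ι ⁻¹' (chartAt V (ι x₀)).source with hO
  have hmaps : MapsTo (fun x => (Bundle.TotalSpace.mk' (V →L[ℝ] ℝ) (ι x) (σ x) :
      Bundle.TotalSpace (V →L[ℝ] ℝ)
        (fun p : M => TangentSpace 𝓘(ℝ, V) p →L[ℝ] Bundle.Trivial M ℝ p))) O T.source := by
    intro x hx
    rw [hT, hom_trivializationAt_source]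
    exact ⟨hx.2, mem_univ _⟩
  have hsm := ((T.contMDiffOn_iff hmaps).1 (hσ.mono inter_subset_left)).2
  refine ⟨_, O, hU.inter ((chartAt V (ι x₀)).open_source.preimage hι), ⟨hx₀, mem_chart_source V _⟩,
    hsm, fun x hx => ?_⟩
  ext u
  have h1 := TangentBundle.continuousLinearMapAt_trivializationAt (I := 𝓘(ℝ, V)) hx.2
  have hb : ι x ∈ (trivializationAt V (TangentSpace 𝓘(ℝ, V)) (ι x₀)).baseSet := hx.2
  have h2 := (trivializationAt V (TangentSpace 𝓘(ℝ, V)) (ι x₀)).symmL_continuousLinearMapAt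
    (R := ℝ) hb u
  rw [h1] at h2
  have h3 : ∀ v : V, (T (Bundle.TotalSpace.mk' (V →L[ℝ] ℝ) (ι x) (σ x))).2 v
      = σ x ((trivializationAt V (TangentSpace 𝓘(ℝ, V)) (ι x₀)).symmL ℝ (ι x) v) := by
    intro v
    rw [hT, hom_trivializationAt_apply]
    simp [ContinuousLinearMap.inCoordinates]
  exact (congrArg (σ x) h2).symm.trans (h3 _).symm

variable [FiniteDimensional ℝ W] [T2Space S]

/-- A smooth section of `T*_S M` restricts to a smooth section of `E*`. -/
theorem ExponentialMap.exists_linearPart_eq_of_section (e : ExponentialMap V W ι F E)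
    {σ : ∀ x : S, Cotangent V (ι x)} {U : Set S} (hU : IsOpen U)
    (hσ : ContMDiffOn 𝓘(ℝ, W) (𝓘(ℝ, V).prod 𝓘(ℝ, V →L[ℝ] ℝ)) ∞
      (fun x => (Bundle.TotalSpace.mk' (V →L[ℝ] ℝ) (ι x) (σ x) :
        Bundle.TotalSpace (V →L[ℝ] ℝ)
          (fun p : M => TangentSpace 𝓘(ℝ, V) p →L[ℝ] Bundle.Trivial M ℝ p))) U)
    {x₀ : S} (hx₀ : x₀ ∈ U) :
    ∃ c : affineFunctions W F E, IsFiberwiseLinear c ∧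
      ∀ᶠ x in 𝓝 x₀, ∀ v, linearPart c x v = σ x (e.normalMap x v) := by
  have hι := e.contMDiff_base.continuous
  obtain ⟨s, O, hO, hxO, hs, hσs⟩ := exists_coefficients hU hσ hι hx₀
  set b := Module.finBasis ℝ V
  choose s' hs' using fun i => exists_smooth_extension (V := W) hO
    (hs.clm_apply (contMDiffOn_const (c := b i))) hxO
  choose h hh using fun i => exists_smooth_extension_chart
    (b.coord i).toContinuousLinearMap.contDiff (ι x₀)
  set l : Fin (Module.finrank ℝ V) → affineFunctions W F E := fun i =>
    e.affineJet (h i) (h i).contMDiff.contMDiffOn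
  -- The jets of the coordinate functions, with their values on `S` removed; these span the
  -- restrictions of covectors to `E`.
  set l' : Fin (Module.finrank ℝ V) → affineFunctions W F E := fun i =>
    l i - ofBase (basePart (l i))
  have hl' : ∀ i, IsFiberwiseLinear (l' i) := fun i => isFiberwiseLinear_sub_ofBase _
  have heval : ∀ w, (∑ i, affineMul (ofBase (s' i)) (l' i)).1 w
      = ∑ i, (affineMul (ofBase (s' i)) (l' i)).1 w := fun w =>
    map_sum (({ toFun := fun φ => φ.1 w, map_zero' := rfl, map_add' := fun _ _ => rfl } :
      affineFunctions W F E →+ ℝ)) _ _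
  have hlin : IsFiberwiseLinear (∑ i, affineMul (ofBase (s' i)) (l' i)) := fun x => by
    rw [heval]
    refine Finset.sum_eq_zero fun i _ => ?_
    rw [affineMul_ofBase, hl' i, mul_zero]
  refine ⟨_, hlin, ?_⟩
  filter_upwards [hO.mem_nhds hxO, eventually_all.2 hs',
    hι.continuousAt.eventually (eventually_all.2 fun i => (hh i).eventuallyEq_nhds),
    hι.continuousAt.preimage_mem_nhds (extChartAt_source_mem_nhds (I := 𝓘(ℝ, V)) (ι x₀))]
    with x hxO' hxs hxh hxc v
  have hxc' : ι x ∈ (chartAt V (ι x₀)).source := by simpa [extChartAt_source] using hxc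
  set u : V := mfderiv 𝓘(ℝ, V) 𝓘(ℝ, V) (extChartAt 𝓘(ℝ, V) (ι x₀)) (ι x) (e.normalMap x v) with hu
  have h1 : ∀ i, (l' i).1 ⟨x, v⟩ = b.coord i u := fun i => by
    have h2 : (l' i).1 ⟨x, v⟩ = linearPart (l i) x v := rfl
    rw [h2, e.linearPart_affineJet]
    have h3 := mfderiv_comp (I'' := 𝓘(ℝ, ℝ)) (ι x)
      (b.coord i).toContinuousLinearMap.differentiableAt.mdifferentiableAt
      (mdifferentiableAt_extChartAt (I := 𝓘(ℝ, V)) hxc')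
    rw [mfderiv_eq_fderiv, ContinuousLinearMap.fderiv] at h3
    exact congrArg (fun L => L (e.normalMap x v))
      (((hxh i).mfderiv_eq (I := 𝓘(ℝ, V)) (I' := 𝓘(ℝ, ℝ))).trans h3)
  rw [hlin.linearPart_apply, heval]
  simp only [affineMul_ofBase, h1, hxs]
  refine Eq.trans ?_ (congrArg (fun L => L (e.normalMap x v)) (hσs x hxO')).symm
  change _ = s x u
  conv_rhs => rw [← b.sum_repr u, map_sum]
  refine Finset.sum_congr rfl fun i _ => ?_
  rw [map_smul, smul_eq_mul, mul_comm]
  rfl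

theorem ExponentialMap.differential_pushforward_tangent (e : ExponentialMap V W ι F E)
    {η : affineFunctions W F E} (hη : IsFiberwiseLinear η) (x : S) :
    (differential V (e.pushforward η) (ι x)).comp (mfderiv 𝓘(ℝ, W) 𝓘(ℝ, V) ι x) = 0 := by
  rw [e.differential_comp_base (e.contMDiffOn_pushforward η)]
  simp only [e.pushforward_base]
  have h : (fun x => η.1 ⟨x, 0⟩) = fun _ : S => (0 : ℝ) := funext hη
  rw [h]
  exact mfderiv_const

/-- A conormal vector is determined by its restriction to the fiber of `E`. -/
theorem ExponentialMap.differential_pushforward_eq (e : ExponentialMap V W ι F E)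
    {η : affineFunctions W F E} (hη : IsFiberwiseLinear η) {x : S} {α : Cotangent V (ι x)}
    (hα : α ∈ conormalSpace V W ι x) (h : ∀ v, linearPart η x v = α (e.normalMap x v)) :
    differential V (e.pushforward η) (ι x) = α := by
  refine sub_eq_zero.1 (e.covector_eq_zero (fun w => ?_) fun v => ?_)
  · exact sub_eq_zero.2 ((congrArg (fun L => L w)
      (e.differential_pushforward_tangent hη x)).trans (hα w).symm)
  · exact sub_eq_zero.2 ((e.differential_pushforward_normalMap η x v).trans (h v))

/-- Functions vanishing on `S` have conormal differentials, and these lie in the kernel of `π`.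
There the isotropy bracket is computed by arbitrary functions with the given differentials. -/
theorem IsPoissonSubmanifold.linearPart_affineBracket (hS : IsPoissonSubmanifold ψ π ι)
    (e : ExponentialMap V W ι F E) {η ξ : affineFunctions W F E} (hη : IsFiberwiseLinear η)
    (hξ : IsFiberwiseLinear ξ) (x : S) (v : E x) :
    linearPart (affineBracket π e η ξ) x v
      = π.isotropyBracket (ι x) (differential V (e.pushforward η) (ι x))
        (differential V (e.pushforward ξ) (ι x)) (e.normalMap x v) := by
  have hker : ∀ {η : affineFunctions W F E}, IsFiberwiseLinear η → ∀ α,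
      π.bivector (ι x) α (differential V (e.pushforward η) (ι x)) = 0 := fun hη α => by
    rw [hS.poisson, e.differential_pushforward_tangent hη, map_zero]
  rw [π.isotropyBracket_differential e.toHomeo.open_target (e.contMDiffOn_pushforward η)
    (e.contMDiffOn_pushforward ξ) (e.base_mem_target x) (hker hη) (hker hξ),
    affineBracket_eq_affineJet, e.linearPart_affineJet]

/-- Fiberwise linear functions, near a point of `S`, are families of elements of `𝔤`. -/
theorem IsPoissonSubmanifold.exists_lieFrame [FiniteDimensional ℝ F]
    (hS : IsPoissonSubmanifold ψ π ι)
    (e : ExponentialMap V W ι F E) {𝔤 : Type*} [LieRing 𝔤] [LieAlgebra ℝ 𝔤]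
    (hE : IsLocallyTrivialLieBundle W π ι 𝔤) (x₀ : S) :
    ∃ (U : Set S) (Θ : ∀ x : S, 𝔤 →ₗ[ℝ] E x →ₗ[ℝ] ℝ), U ∈ 𝓝 x₀ ∧
      (∀ x ∈ U, Function.Bijective (Θ x)) ∧
      (∀ x ∈ U, ∀ η ξ : affineFunctions W F E, IsFiberwiseLinear η → IsFiberwiseLinear ξ →
        ∀ a c : 𝔤, linearPart η x = Θ x a → linearPart ξ x = Θ x c →
          linearPart (affineBracket π e η ξ) x = Θ x ⁅a, c⁆) ∧
      ∀ a : 𝔤, ∃ η : affineFunctions W F E, IsFiberwiseLinear η ∧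
        ∀ᶠ x in 𝓝 x₀, linearPart η x = Θ x a := by
  obtain ⟨U, hU, hx₀, φ, hinj, hrange, hbr, hsm⟩ := hE x₀
  -- The trivialization of the conormal bundle, carried over to `E*` by restricting covectors to the
  -- fiber directions.
  set Θ : ∀ x : S, 𝔤 →ₗ[ℝ] E x →ₗ[ℝ] ℝ := fun x =>
    { toFun := fun a => (φ x a).toLinearMap ∘ₗ e.normalMap x
      map_add' := fun a c => by ext v; rw [map_add]; rfl
      map_smul' := fun r a => by ext v; rw [map_smul]; rfl }
  have hΘ : ∀ x a v, Θ x a v = φ x a (e.normalMap x v) := fun _ _ _ => rfl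
  have hcon : ∀ x ∈ U, ∀ a, φ x a ∈ conormalSpace V W ι x := fun x hx a => by
    rw [← hrange x hx]
    exact LinearMap.mem_range_self _ _
  refine ⟨U, Θ, hU.mem_nhds hx₀, fun x hx => ⟨?_, fun l => ?_⟩, ?_, fun a => ?_⟩
  -- A conormal covector that also vanishes along the fiber of `E` is zero.
  · refine (injective_iff_map_eq_zero _).2 fun a ha => ?_
    refine (injective_iff_map_eq_zero (φ x)).1 (hinj x hx) a ?_
    exact e.covector_eq_zero (hcon x hx a) fun v => congrArg (fun L => L v) ha
  -- Surjectivity: the form extends to a fiberwise linear function, whose differential is conormal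
  -- and hence in the image of `φ x`.
  · obtain ⟨η, hη, rfl⟩ := exists_linearPart_eq (W := W) (F := F) l
    have h1 : differential V (e.pushforward η) (ι x) ∈ LinearMap.range (φ x) := by
      rw [hrange x hx]
      exact fun w => congrArg (fun L => L w) (e.differential_pushforward_tangent hη x)
    obtain ⟨a, ha⟩ := h1
    refine ⟨a, ?_⟩
    ext v
    rw [hΘ, ha, e.differential_pushforward_normalMap]
  · intro x hx η ξ hη hξ a c ha hc
    ext v
    rw [hS.linearPart_affineBracket e hη hξ, hΘ, hbr x hx,
      e.differential_pushforward_eq hη (hcon x hx a) (fun v => by rw [ha, hΘ]),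
      e.differential_pushforward_eq hξ (hcon x hx c) (fun v => by rw [hc, hΘ])]
  · obtain ⟨η, hη, h⟩ := e.exists_linearPart_eq_of_section hU (hsm a) hx₀
    refine ⟨η, hη, ?_⟩
    filter_upwards [h] with x hx
    ext v
    rw [hx, hΘ]

/-- Local fiberwise linear functions which agree fiber by fiber glue. -/
theorem exists_isFiberwiseLinear_glue {P : S → affineFunctions W F E → Prop}
    (hloc : ∀ x₀ : S, ∃ ζ, IsFiberwiseLinear ζ ∧ ∀ᶠ x in 𝓝 x₀, P x ζ)
    (huniq : ∀ x ζ ζ', IsFiberwiseLinear ζ → IsFiberwiseLinear ζ' → P x ζ → P x ζ' →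
      linearPart ζ x = linearPart ζ' x)
    (hcongr : ∀ x ζ ζ', IsFiberwiseLinear ζ → IsFiberwiseLinear ζ' →
      linearPart ζ x = linearPart ζ' x → P x ζ → P x ζ') :
    ∃ ζ, IsFiberwiseLinear ζ ∧ ∀ x, P x ζ := by
  choose ζ hζ hP using hloc
  -- By uniqueness the choice made at `x` agrees on `E_x` with the one made at a nearby `x₀`, so the
  -- diagonal function `w ↦ ζ w.proj w` is locally a single smooth function.
  have heq : ∀ x₀, ∀ᶠ x in 𝓝 x₀, linearPart (ζ x) x = linearPart (ζ x₀) x := fun x₀ => by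
    filter_upwards [hP x₀] with x hx
    exact huniq x _ _ (hζ _) (hζ _) (hP x).self_of_nhds hx
  have hsmooth : ContMDiff (𝓘(ℝ, W).prod 𝓘(ℝ, F)) 𝓘(ℝ, ℝ) ∞
      (fun w : Bundle.TotalSpace F E => (ζ w.proj).1 w) := fun w₀ => by
    refine (ζ w₀.proj).1.contMDiff.contMDiffAt.congr_of_eventuallyEq ?_
    filter_upwards [(Bundle.contMDiff_proj (n := ∞) (IB := 𝓘(ℝ, W))
      E).continuous.continuousAt.eventually (heq w₀.proj)] with w hw
    have h := congrArg (fun l => l w.snd) hw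
    simp only [(hζ _).linearPart_apply] at h
    exact h
  set Z : affineFunctions W F E := ⟨⟨_, hsmooth⟩, fun x => (ζ x).2 x⟩
  have hZ : IsFiberwiseLinear Z := fun x => hζ x x
  exact ⟨Z, hZ, fun x => hcongr x (ζ x) Z (hζ x) hZ rfl (hP x).self_of_nhds⟩

end LieFrames

/-! ### Vanishing of the first cohomology -/

section Vanishing

variable {V : Type*} [NormedAddCommGroup V] [NormedSpace ℝ V]
  {M : Type*} [TopologicalSpace M] [ChartedSpace V M]
  {W : Type*} [NormedAddCommGroup W] [NormedSpace ℝ W]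
  {S : Type*} [TopologicalSpace S] [ChartedSpace W S]
  {F : Type*} [NormedAddCommGroup F] [NormedSpace ℝ F]
  {E : S → Type*} [∀ x, AddCommGroup (E x)] [∀ x, Module ℝ (E x)]
  [TopologicalSpace (Bundle.TotalSpace F E)] [∀ x, TopologicalSpace (E x)]
  [FiberBundle F E] [VectorBundle ℝ F E]
  {ι : S → M}
  [FiniteDimensional ℝ V] [IsManifold 𝓘(ℝ, V) ∞ M] [T2Space M] [IsManifold 𝓘(ℝ, W) ∞ S]
  [ContMDiffVectorBundle ∞ F E 𝓘(ℝ, W)]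
  {ψ : PoissonStructure W S} {π : PoissonStructure V M}
  [FiniteDimensional ℝ W] [T2Space S] [FiniteDimensional ℝ F]
  {𝔤 : Type*} [LieRing 𝔤] [LieAlgebra ℝ 𝔤] [FiniteDimensional ℝ 𝔤] [LieAlgebra.IsKilling ℝ 𝔤]
  {e : ExponentialMap V W ι F E}

theorem linearPart_sum {n : ℕ} (φ : Fin n → affineFunctions W F E) (x : S) :
    linearPart (∑ i, φ i) x = ∑ i, linearPart (φ i) x :=
  map_sum (({ toFun := fun φ => linearPart φ x
              map_add' := fun φ χ => linearPart_add φ χ x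
              map_zero' := by ext v; exact sub_self (0 : ℝ) } :
    affineFunctions W F E →+ (E x →ₗ[ℝ] ℝ))) φ Finset.univ

theorem IsFiberwiseLinear.sum {n : ℕ} {φ : Fin n → affineFunctions W F E}
    (h : ∀ i, IsFiberwiseLinear (φ i)) : IsFiberwiseLinear (∑ i, φ i) := fun x =>
  (map_sum (({ toFun := fun φ => φ.1 ⟨x, 0⟩, map_zero' := rfl, map_add' := fun _ _ => rfl } :
    affineFunctions W F E →+ ℝ)) φ Finset.univ).trans (Finset.sum_eq_zero fun i _ => h i x)

/-- In a frame this is the triviality of the centre of `𝔤`, as every element of the fiber is the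
value of some section. -/
theorem IsPoissonSubmanifold.linearPart_eq_zero_of_bracket (hS : IsPoissonSubmanifold ψ π ι)
    (hE : IsLocallyTrivialLieBundle W π ι 𝔤) {ζ : affineFunctions W F E}
    (hζ : IsFiberwiseLinear ζ) {x : S}
    (h : ∀ η, IsFiberwiseLinear η → linearPart (affineBracket π e ζ η) x = 0) :
    linearPart ζ x = 0 := by
  obtain ⟨U, Θ, hU, hbij, hbr, -⟩ := hS.exists_lieFrame e hE x
  have hx := mem_of_mem_nhds hU
  obtain ⟨a, ha⟩ := (hbij x hx).2 (linearPart ζ x)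
  have h0 : a = 0 := eq_zero_of_forall_lie_eq_zero fun c => by
    obtain ⟨η, hη, hc⟩ := exists_linearPart_eq (W := W) (F := F) (Θ x c)
    refine (injective_iff_map_eq_zero (Θ x)).1 (hbij x hx).1 _ ?_
    rw [← hbr x hx ζ η hζ hη a c ha.symm hc, h η hη]
  rw [← ha, h0, map_zero]

theorem IsPoissonSubmanifold.linearPart_affineBracket_congr (hS : IsPoissonSubmanifold ψ π ι)
    (hE : IsLocallyTrivialLieBundle W π ι 𝔤) {ζ ζ' η : affineFunctions W F E}
    (hζ : IsFiberwiseLinear ζ) (hζ' : IsFiberwiseLinear ζ') (hη : IsFiberwiseLinear η) {x : S}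
    (h : linearPart ζ x = linearPart ζ' x) :
    linearPart (affineBracket π e ζ η) x = linearPart (affineBracket π e ζ' η) x := by
  obtain ⟨U, Θ, hU, hbij, hbr, -⟩ := hS.exists_lieFrame e hE x
  have hx := mem_of_mem_nhds hU
  obtain ⟨a, ha⟩ := (hbij x hx).2 (linearPart ζ x)
  obtain ⟨c, hc⟩ := (hbij x hx).2 (linearPart η x)
  rw [hbr x hx ζ η hζ hη a c ha.symm hc.symm,
    hbr x hx ζ' η hζ' hη a c (h.symm.trans ha.symm) hc.symm]

/-- A derivation with values in the fiberwise linear functions is locally inner on them. -/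
theorem IsPoissonDerivation.exists_local_inner (hS : IsPoissonSubmanifold ψ π ι)
    (hE : IsLocallyTrivialLieBundle W π ι 𝔤)
    {X : affineFunctions W F E →ₗ[ℝ] affineFunctions W F E} (hX : IsPoissonDerivation π e X)
    (hX0 : ∀ φ, IsFiberwiseLinear (X φ)) (x₀ : S) :
    ∃ ζ, IsFiberwiseLinear ζ ∧ ∀ᶠ x in 𝓝 x₀, ∀ η, IsFiberwiseLinear η →
      linearPart (X η) x = linearPart (affineBracket π e ζ η) x := by
  obtain ⟨n, a, b, hab⟩ := exists_casimir 𝔤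
  obtain ⟨U, Θ, hU, hbij, hbr, hfr⟩ := hS.exists_lieFrame e hE x₀
  choose A hA hA' using fun i => hfr (a i)
  choose B hB hB' using fun i => hfr (b i)
  have hterm : ∀ i, IsFiberwiseLinear (affineBracket π e (A i) (X (B i))) := fun i =>
    hS.isFiberwiseLinear_affineBracket e _ (hX0 _)
  -- The candidate `-∑ {A_i, X B_i}` is smooth by construction; the Casimir identity will show that
  -- it induces `X` on every nearby fiber.
  have hsum := (IsFiberwiseLinear.sum hterm).smul (-1)
  refine ⟨_, hsum, ?_⟩
  filter_upwards [hU, eventually_all.2 hA', eventually_all.2 hB'] with x hx hAx hBx η hη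
  have hex : ∀ c : 𝔤, ∃ ξ : affineFunctions W F E, IsFiberwiseLinear ξ ∧ linearPart ξ x = Θ x c :=
    fun c => exists_linearPart_eq _
  choose ξ hξ hξx using hex
  set Ψ := LinearEquiv.ofBijective (Θ x) (hbij x hx) with hΨ
  have hΨΘ : ∀ l, Θ x (Ψ.symm l) = l := Ψ.apply_symm_apply
  have hΘΨ : ∀ c, Ψ.symm (Θ x c) = c := Ψ.symm_apply_apply
  have hXc : ∀ {η : affineFunctions W F E} {c : 𝔤}, IsFiberwiseLinear η → linearPart η x = Θ x c →
      linearPart (X η) x = linearPart (X (ξ c)) x := fun hη hc =>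
    hX.linearPart_congr hX0 hη (hξ _) (hc.trans (hξx _).symm)
  -- The action of `X` on the fiber at `x`, read in `𝔤`. Tensoriality makes it independent of the
  -- sections `ξ c` chosen to extend the elements, and hence linear.
  set D : 𝔤 →ₗ[ℝ] 𝔤 :=
    { toFun := fun c => Ψ.symm (linearPart (X (ξ c)) x)
      map_add' := fun c d => by
        rw [← map_add, ← linearPart_add, ← map_add,
          hXc ((hξ c).add (hξ d)) (by rw [linearPart_add, hξx, hξx, map_add])]
      map_smul' := fun r c => by
        rw [RingHom.id_apply, ← map_smul, ← linearPart_smul, ← map_smul,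
          hXc ((hξ c).smul r) (by rw [linearPart_smul, hξx, map_smul])] }
  have hD : ∀ {η : affineFunctions W F E} {c : 𝔤}, IsFiberwiseLinear η → linearPart η x = Θ x c →
      linearPart (X η) x = Θ x (D c) := fun hη hc => by
    rw [hXc hη hc]
    exact (hΨΘ _).symm
  obtain ⟨z, hz⟩ := exists_eq_lie_of_derivation D fun c d => by
    refine (hbij x hx).1 ?_
    rw [map_add, ← hbr x hx _ _ (hX0 (ξ c)) (hξ d) _ _ (hD (hξ c) (hξx c)) (hξx d),
      ← hbr x hx _ _ (hξ c) (hX0 (ξ d)) _ _ (hξx c) (hD (hξ d) (hξx d)), ← linearPart_add,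
      ← hX.bracket]
    exact (hD (hS.isFiberwiseLinear_affineBracket e _ (hξ d))
      (hbr x hx _ _ (hξ c) (hξ d) _ _ (hξx c) (hξx d))).symm
  -- With `D = [z, ·]`, the terms `-[a_i, [z, b_i]] = [a_i, [b_i, z]]` add up to `z`.
  have hζ : linearPart ((-1 : ℝ) • ∑ i, affineBracket π e (A i) (X (B i))) x = Θ x z := by
    have h1 : ∀ i, linearPart (affineBracket π e (A i) (X (B i))) x = Θ x ⁅a i, ⁅z, b i⁆⁆ :=
      fun i => by rw [hbr x hx _ _ (hA i) (hX0 _) _ _ (hAx i) (hD (hB i) (hBx i)), hz]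
    rw [linearPart_smul, linearPart_sum]
    simp only [h1]
    rw [← map_sum, ← map_smul, neg_one_smul, ← Finset.sum_neg_distrib]
    congr 1
    refine Eq.trans (Finset.sum_congr rfl fun i _ => ?_) (hab z)
    rw [← lie_neg, lie_skew]
  obtain ⟨c, hc⟩ := (hbij x hx).2 (linearPart η x)
  rw [hD hη hc.symm, hz, hbr x hx _ _ hsum hη _ _ hζ hc.symm]

/-- Two local solutions differ by an element that brackets trivially with the fiber, hence by zero;
so the local solutions glue. -/
theorem IsPoissonDerivation.exists_inner (hS : IsPoissonSubmanifold ψ π ι)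
    (hE : IsLocallyTrivialLieBundle W π ι 𝔤)
    {X : affineFunctions W F E →ₗ[ℝ] affineFunctions W F E} (hX : IsPoissonDerivation π e X)
    (hX0 : ∀ φ, IsFiberwiseLinear (X φ)) :
    ∃ ζ, IsFiberwiseLinear ζ ∧ ∀ η, IsFiberwiseLinear η → X η = affineBracket π e ζ η := by
  obtain ⟨ζ, hζ, h⟩ := exists_isFiberwiseLinear_glue
    (P := fun x ζ => ∀ η, IsFiberwiseLinear η →
      linearPart (X η) x = linearPart (affineBracket π e ζ η) x)
    (hX.exists_local_inner hS hE hX0)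
    (fun x ζ ζ' hζ hζ' h h' => by
      have hsub : ∀ η ξ : affineFunctions W F E,
          linearPart (η - ξ) x = linearPart η x - linearPart ξ x := fun η ξ => by
        rw [eq_sub_iff_add_eq, ← linearPart_add, sub_add_cancel]
      have h1 := hS.linearPart_eq_zero_of_bracket (e := e) hE (hζ.sub hζ') (x := x) fun η hη => by
        have h2 : affineBracket π e ζ η = affineBracket π e (ζ - ζ') η + affineBracket π e ζ' η := by
          rw [← affineBracket_add_left, sub_add_cancel]
        have h3 := (h η hη).symm.trans (h' η hη)
        rw [h2, linearPart_add] at h3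
        exact add_eq_right.1 h3
      rw [hsub] at h1
      exact sub_eq_zero.1 h1)
    (fun x ζ ζ' hζ hζ' hl h η hη =>
      (h η hη).trans (hS.linearPart_affineBracket_congr hE hζ hζ' hη hl))
  exact ⟨ζ, hζ, fun η hη => (hX0 η).ext (hS.isFiberwiseLinear_affineBracket e ζ hη) fun x =>
    h x η hη⟩

theorem IsPoissonSubmanifold.infinitesimalFirstCohomologyTrivial (hS : IsPoissonSubmanifold ψ π ι)
    (e : ExponentialMap V W ι F E) (hE : IsLocallyTrivialLieBundle W π ι 𝔤)
    (hψ : ψ.FirstCohomologyTrivial) : InfinitesimalFirstCohomologyTrivial π e := by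
  intro X hX
  obtain ⟨h, hh⟩ := hX.exists_hamiltonian hS hψ
  -- Removing `{h, ·}` kills the induced vector field on `S`, so all values become fiberwise linear.
  have hX1 := hX.sub (hS.isPoissonDerivation_affineHamiltonian e (ofBase h))
  set X₁ := X - affineHamiltonian π e (ofBase h) with hX1_def
  have hX10 : ∀ φ, IsFiberwiseLinear (X₁ φ) := fun φ x => by
    change (X φ).1 ⟨x, 0⟩ - (affineBracket π e (ofBase h) φ).1 ⟨x, 0⟩ = 0
    rw [hX.apply_zero_section, hh, hS.affineBracket_zero_section]
    exact sub_self _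
  obtain ⟨ζ, hζ, hζX⟩ := hX1.exists_inner hS hE hX10
  have hX2 := hX1.sub (hS.isPoissonDerivation_affineHamiltonian e ζ)
  set X₂ := X₁ - affineHamiltonian π e ζ with hX2_def
  -- Subtracting `{ζ, ·}` keeps the values fiberwise linear, as the bracket with a fiberwise linear
  -- function is again so.
  have hX20 : ∀ φ, IsFiberwiseLinear (X₂ φ) := fun φ =>
    (hX10 φ).sub (hS.isFiberwiseLinear_affineBracket_left e φ hζ)
  have hX2L : ∀ η, IsFiberwiseLinear η → X₂ η = 0 := fun η hη =>
    sub_eq_zero.2 (hζX η hη)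
  have hX2_zero : ∀ φ, X₂ φ = 0 := fun φ => by
    refine (hX20 φ).ext (fun _ => rfl) fun x => ?_
    have h0 : linearPart (0 : affineFunctions W F E) x = 0 := by
      ext v
      exact sub_self (0 : ℝ)
    rw [h0]
    refine hS.linearPart_eq_zero_of_bracket (e := e) hE (hX20 φ) fun η hη => ?_
    -- Both `η` and `{φ, η}` are fiberwise linear and are killed by `X₂`, so the bracket rule
    -- reduces to `{X₂ φ, η} = 0`.
    have h1 := hX2.bracket φ η
    have h2 : affineBracket π e φ (0 : affineFunctions W F E) = 0 :=
      map_zero (affineHamiltonian π e φ)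
    rw [hX2L _ (hS.isFiberwiseLinear_affineBracket e φ hη), hX2L η hη, h2, add_zero] at h1
    rw [← h1, h0]
  refine ⟨ofBase h + ζ, fun χ => ?_⟩
  rw [affineBracket_add_left]
  have h1 : X χ - affineBracket π e (ofBase h) χ - affineBracket π e ζ χ = 0 := hX2_zero χ
  rw [sub_sub, sub_eq_zero] at h1
  exact h1

end Vanishing

end PoissonGeometry

end

theorem proposition2p2
    {V : Type*} [NormedAddCommGroup V] [NormedSpace ℝ V] [FiniteDimensional ℝ V]
    {M : Type*} [TopologicalSpace M] [ChartedSpace V M] [IsManifold 𝓘(ℝ, V) ∞ M]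
    [T2Space M] [SecondCountableTopology M]
    {W : Type*} [NormedAddCommGroup W] [NormedSpace ℝ W] [FiniteDimensional ℝ W]
    {S : Type*} [TopologicalSpace S] [ChartedSpace W S] [IsManifold 𝓘(ℝ, W) ∞ S]
    [T2Space S] [SecondCountableTopology S]
    {F : Type*} [NormedAddCommGroup F] [NormedSpace ℝ F] [FiniteDimensional ℝ F]
    {E : S → Type*} [∀ x, AddCommGroup (E x)] [∀ x, Module ℝ (E x)]
    [TopologicalSpace (Bundle.TotalSpace F E)] [∀ x, TopologicalSpace (E x)]
    [FiberBundle F E] [VectorBundle ℝ F E] [ContMDiffVectorBundle ∞ F E 𝓘(ℝ, W)]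
    {𝔤 : Type*} [LieRing 𝔤] [LieAlgebra ℝ 𝔤] [FiniteDimensional ℝ 𝔤]
    (π : PoissonGeometry.PoissonStructure V M) (ψ : PoissonGeometry.PoissonStructure W S)
    (ι : S → M) (hS : PoissonGeometry.IsPoissonSubmanifold ψ π ι)
    (e : PoissonGeometry.ExponentialMap V W ι F E)
    (hE : PoissonGeometry.IsLocallyTrivialLieBundle W π ι 𝔤)
    (h𝔤 : PoissonGeometry.IsSemisimpleOfCompactType 𝔤)
    (hψ : ψ.FirstCohomologyTrivial) :
    PoissonGeometry.InfinitesimalFirstCohomologyTrivial π e := by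
  have := h𝔤.isKilling
  exact hS.infinitesimalFirstCohomologyTrivial e hE hψ
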